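/- Let $n,m,p\ge 1$, $1\le r\le K\le \min(m,p)$, $\sigma>0$, $\alpha\in(0,1)$, $a>0$, $B>0$, $C>0$. Model. For $M\in\mathbb R^{m\times p}$ let $P_M$ be the law of $((i,j),Y)$ with $(i,j)$ uniform on $\{1,\dots,m\}\times\{1,\dots,p\}$ and $Y=M_{i,j}+\xi$, where $\xi\sim\mathcal N(0,\sigma^2)$ is independent of $(i,j)$. The sample $X_1^n=(X_1,\dots,X_n)$ is i.i.d. from $P_{M_0}$; $L_n(M)$ denotes the likelihood. Prior. $\theta=(\gamma,U,V)$ with $\gamma\in(0,\infty)^K$, $U\in\mathbb R^{m\times K}$, $V\in\mathbb R^{p\times K}$. Under $\pi$, the $1/\gamma_k$ are i.i.d. $\Gamma(a,b)$ ($b$ is the rate), and given $\gamma$ all the entries $U_{i,k}$, $V_{j,k}$ are independent with law $\mathcal N(0,\gamma_k)$. Here $b=B^2/\{512\,(nmp)^4[\max(m,p)K]^2\}$. Put $M=UV^t$. VB approximation. Let $\pi_{n,\alpha}(d\theta|X_1^n)\propto L_n(UV^t)^\alpha\,\pi(d\theta)$ and let $\mathcal F$ be the set of all probability distributions $\bigotimes_{i=1}^m\rho_{U_i}(dU_{i,\cdot})\bigotimes_{j=1}^p\rho_{V_j}(dV_{j,\cdot})\bigotimes_{k=1}^K\rho_{\gamma_k}(d\gamma_k)$.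 Let $\tilde\pi_{n,\alpha}(\cdot|X_1^n)$ be any minimizer of the Kullback-Leibler divergence $\rho\mapsto\mathcal K(\rho,\pi_{n,\alpha}(\cdot|X_1^n))$ over $\mathcal F$. Assume $M_0=\bar U\bar V^t$ where $\bar U\in\mathbb R^{m\times K}$ and $\bar V\in\mathbb R^{p\times K}$ have all entries bounded by $B$ in absolute value and $\bar U_{i,\ell}=\bar V_{j,\ell}=0$ for $\ell>r$, and assume $\max_{i,j}|(M_0)_{i,j}|\le C$. Let $\mathrm{clip}_C(M)$ be the matrix with entries $\min(\max(M_{i,j},-C),C)$, and let $\mathcal C(a)=\log(8\sqrt\pi\,\Gamma(a)2^{10a+1})+3$. Then $$\mathbb E\left[\int \frac{\|\mathrm{clip}_C(M)-M_0\|_F^2}{mp}\,\tilde\pi_{n,\alpha}(dM|X_1^n)\right]\le\frac{8C^2(1+\alpha)(1+2a)\,r(m+p)\left[\log(nmp)+\mathcal C(a)+\frac{\alpha B}{2\sigma^2mp}\max\left\{1,\left(\frac{B}{nmp}\right)^3\right\}\right]}{n\left[1-\exp\left(2C^2\alpha(\alpha-1)/\sigma^2\right)\right]}.$$ In particular, for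 $B\le nmp$ the term in $B$ is $\frac{\alpha B}{2\sigma^2mp}$. -/

import Mathlib

open MeasureTheory ProbabilityTheory
open scoped ENNReal NNReal Matrix

namespace MatrixCompletionVB

noncomputable section

/-! ### The model -/

/-- One observation: a position `(i, j)` together with a noisy value of that entry. -/
abbrev Obs (m p : ℕ) : Type := (Fin m × Fin p) × ℝ

/-- The law `P_M` of one observation `((i, j), Y)`: the position is uniform, the noise `ξ` is
independent of it with law `N(0, σ²)`, and `Y = M i j + ξ`. -/
def obsLaw {m p : ℕ} (σ : ℝ) (M : Matrix (Fin m) (Fin p) ℝ) : Measure (Obs m p) :=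
  ((uniformOn (Set.univ : Set (Fin m × Fin p))).prod
      (gaussianReal 0 (Real.toNNReal (σ ^ 2)))).map
    (fun z => (z.1, M z.1.1 z.1.2 + z.2))

/-- The law of an i.i.d. sample of size `n` from `P_M`. -/
def sampleLaw {m p : ℕ} (n : ℕ) (σ : ℝ) (M : Matrix (Fin m) (Fin p) ℝ) :
    Measure (Fin n → Obs m p) :=
  Measure.pi fun _ => obsLaw σ M

/-- The log-likelihood of `M`, with densities taken with respect to the product of the uniform
law of the position and Lebesgue measure. -/
def logLikelihood {m p n : ℕ} (σ : ℝ) (x : Fin n → Obs m p) (M : Matrix (Fin m) (Fin p) ℝ) : ℝ :=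
  ∑ k, Real.log (gaussianPDFReal (M (x k).1.1 (x k).1.2) (Real.toNNReal (σ ^ 2)) (x k).2)

/-! ### Parameters and prior -/

/-- Parameters `(γ, (U, V))`: the vector `γ` of variances, `U` of size `m × K` and `V` of size
`p × K`, both given by their rows. -/
abbrev Param (m p K : ℕ) : Type :=
  (Fin K → ℝ) × ((Fin m → Fin K → ℝ) × (Fin p → Fin K → ℝ))

/-- The matrix `U Vᵗ`. -/
def Param.toMatrix {m p K : ℕ} (θ : Param m p K) : Matrix (Fin m) (Fin p) ℝ :=
  Matrix.of θ.2.1 * (Matrix.of θ.2.2)ᵀ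

/-- The inverse gamma law: the law of `γ` when `1/γ` is `Γ(a, b)` distributed (`b` is a rate). -/
def invGammaMeasure (a b : ℝ) : Measure ℝ :=
  (gammaMeasure a b).map (fun x => x⁻¹)

theorem measurable_measure_pi {ι α : Type*} [Fintype ι] {β : ι → Type*} [MeasurableSpace α]
    [∀ i, MeasurableSpace (β i)] (κ : ∀ i, α → Measure (β i))
    [∀ i a, IsProbabilityMeasure (κ i a)] (h : ∀ i, Measurable (κ i)) :
    Measurable fun a => Measure.pi fun i => κ i a := by
  refine Measurable.measure_of_isPiSystem_of_isProbabilityMeasure generateFrom_pi.symm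
    isPiSystem_pi ?_
  rintro _ ⟨t, ht, rfl⟩
  simp only [Measure.pi_pi]
  refine Finset.measurable_prod _ fun i _ => ?_
  exact (Measure.measurable_coe (ht i (Set.mem_univ i))).comp (h i)

/-- Given `γ`, the entries `U i k` of a matrix with `d` rows are independent, with law
`N(0, γ k)`. -/
def gaussianRows (d K : ℕ) : Kernel (Fin K → ℝ) (Fin d → Fin K → ℝ) where
  toFun γ := Measure.pi fun _ => Measure.pi fun k => gaussianReal 0 (Real.toNNReal (γ k))
  measurable' := by
    refine measurable_measure_pi (fun (_ : Fin d) (γ : Fin K → ℝ) =>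
      Measure.pi fun k => gaussianReal 0 (Real.toNNReal (γ k))) fun _ => ?_
    refine measurable_measure_pi (fun (k : Fin K) (γ : Fin K → ℝ) =>
      gaussianReal 0 (Real.toNNReal (γ k))) fun k => ?_
    exact measurable_gaussianReal.comp
      (measurable_const.prodMk (measurable_real_toNNReal.comp (measurable_pi_apply k)))

/-- The prior: the `γ k` are i.i.d. inverse gamma; given `γ`, the entries of `U` and `V` are
independent, `U i k` and `V j k` having law `N(0, γ k)`. -/
def prior (m p K : ℕ) (a b : ℝ) : Measure (Param m p K) :=
  (Measure.pi fun _ : Fin K => invGammaMeasure a b) ⊗ₘ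
    ((gaussianRows m K) ×ₖ (gaussianRows p K))

/-! ### Fractional posterior and variational approximation -/

/-- The fractional posterior, proportional to `L_n(θ) ^ α π(dθ)`. -/
def fracPosterior {m p n : ℕ} (K : ℕ) (a b σ α : ℝ) (x : Fin n → Obs m p) :
    Measure (Param m p K) :=
  (prior m p K a b).tilted fun θ => α * logLikelihood σ x θ.toMatrix

/-- The mean-field family: the rows of `U`, the rows of `V` and the `γ k` are all independent. -/
def meanField (m p K : ℕ) : Set (Measure (Param m p K)) :=
  {ρ | ∃ (ρU : Fin m → Measure (Fin K → ℝ)) (ρV : Fin p → Measure (Fin K → ℝ))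
      (ργ : Fin K → Measure ℝ),
      (∀ i, IsProbabilityMeasure (ρU i)) ∧ (∀ j, IsProbabilityMeasure (ρV j)) ∧
      (∀ k, IsProbabilityMeasure (ργ k)) ∧
      ρ = (Measure.pi ργ).prod ((Measure.pi ρU).prod (Measure.pi ρV))}

/-- `ρ` is a variational Bayes approximation of the fractional posterior: it minimizes the
Kullback-Leibler divergence `K(·, π_{n,α}(·|x))` over the mean-field family. -/
def IsVBApprox {m p n K : ℕ} (a b σ α : ℝ) (x : Fin n → Obs m p) (ρ : Measure (Param m p K)) :
    Prop :=
  IsMinOn (fun ρ' => InformationTheory.klDiv ρ' (fracPosterior K a b σ α x)) (meanField m p K) ρ ∧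
    ρ ∈ meanField m p K

/-! ### Quantities in the bound -/

/-- The pairs of matrices of sizes `m × K` and `p × K` whose columns after the first `r` vanish
and whose entries are bounded by `B` in absolute value. -/
def factorClass (m p K r : ℕ) (B : ℝ) :
    Set (Matrix (Fin m) (Fin K) ℝ × Matrix (Fin p) (Fin K) ℝ) :=
  {W | (∀ i (l : Fin K), r ≤ (l : ℕ) → W.1 i l = 0) ∧ (∀ i l, |W.1 i l| ≤ B) ∧
      (∀ j (l : Fin K), r ≤ (l : ℕ) → W.2 j l = 0) ∧ (∀ j l, |W.2 j l| ≤ B)}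

/-- Entrywise clipping to `[-C, C]`. -/
def clip {m p : ℕ} (C : ℝ) (M : Matrix (Fin m) (Fin p) ℝ) : Matrix (Fin m) (Fin p) ℝ :=
  Matrix.of fun i j => min (max (M i j) (-C)) C

/-- The squared Frobenius norm. -/
def frobeniusSq {m p : ℕ} (M : Matrix (Fin m) (Fin p) ℝ) : ℝ :=
  ∑ i, ∑ j, (M i j) ^ 2

/-- The constant `𝒞(a)`. -/
def constC (a : ℝ) : ℝ :=
  Real.log (8 * √Real.pi * Real.Gamma a * 2 ^ (10 * a + 1)) + 3

/-- The value of the prior parameter `b`. -/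
def bChoice (n m p K : ℕ) (B : ℝ) : ℝ :=
  B ^ 2 / (512 * ((n : ℝ) * m * p) ^ 4 * (((max m p : ℕ) : ℝ) * K) ^ 2)

end

end MatrixCompletionVB

/-!
The Gibbs variational principle turns the moment bound of the `α`-fractional likelihood ratio, an
explicit Rényi divergence between Gaussian laws, into an oracle inequality. The clipped loss is
dominated by that divergence because `1 - exp (-t)` lies above its chord on `[0, T]`. As the
variational approximation minimizes the free energy over the mean-field family, its averaged risk
is at most the free energy of any single mean-field law `ρ`: the divergence of `ρ` from the prior
plus the expected squared error of `ρ`.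

For `ρ`, take Gaussian entries centred at the true factors, with the variance parameter of each
column conditioned to a short interval: away from zero for the `r` nonzero columns, and just
below the rate `b` for the null columns. The very small `b` makes the error of the null columns
negligible, while the prior mass of each interval is only polynomially small, hence the logarithm.
-/

namespace MatrixCompletionVB

open InformationTheory

section VariationalInference

variable {Θ : Type*} [MeasurableSpace Θ] {ρ ρ' π : Measure Θ} [IsProbabilityMeasure ρ]
  [IsProbabilityMeasure ρ'] [IsProbabilityMeasure π] {f g : Θ → ℝ}

theorem klDiv_tilted_ne_top (hfρ : Integrable f ρ) (hfπ : Integrable (fun θ => Real.exp (f θ)) π)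
    (hkl : klDiv ρ π ≠ ∞) : klDiv ρ (π.tilted f) ≠ ∞ := by
  obtain ⟨hac, hllr⟩ := klDiv_ne_top_iff.1 hkl
  exact klDiv_ne_top (hac.trans (absolutelyContinuous_tilted hfπ))
    (integrable_llr_tilted_right hac hfρ hllr hfπ)

theorem toReal_klDiv_tilted (hfρ : Integrable f ρ)
    (hfπ : Integrable (fun θ => Real.exp (f θ)) π) (hkl : klDiv ρ π ≠ ∞) :
    (klDiv ρ (π.tilted f)).toReal
      = (klDiv ρ π).toReal - ∫ θ, f θ ∂ρ + Real.log (∫ θ, Real.exp (f θ) ∂π) := by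
  obtain ⟨hac, hllr⟩ := klDiv_ne_top_iff.1 hkl
  have := isProbabilityMeasure_tilted hfπ
  rw [toReal_klDiv_of_measure_eq (hac.trans (absolutelyContinuous_tilted hfπ)) (by simp),
    toReal_klDiv_of_measure_eq hac (by simp), integral_llr_tilted_right hac hfρ hfπ hllr]

theorem integral_le_toReal_klDiv_add_log_integral_exp (hgρ : Integrable g ρ)
    (hgπ : Integrable (fun θ => Real.exp (g θ)) π) (hkl : klDiv ρ π ≠ ∞) :
    ∫ θ, g θ ∂ρ ≤ (klDiv ρ π).toReal + Real.log (∫ θ, Real.exp (g θ) ∂π) := by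
  have h := toReal_klDiv_tilted hgρ hgπ hkl
  have h_nonneg : 0 ≤ (klDiv ρ (π.tilted g)).toReal := ENNReal.toReal_nonneg
  linarith

theorem integral_le_of_klDiv_tilted_le (hmin : klDiv ρ' (π.tilted f) ≤ klDiv ρ (π.tilted f))
    (hkl : klDiv ρ π ≠ ∞) (hfρ : Integrable f ρ) (hfπ : Integrable (fun θ => Real.exp (f θ)) π)
    (hgρ' : Integrable g ρ') (hfgπ : Integrable (fun θ => Real.exp (f θ + g θ)) π) :
    ∫ θ, g θ ∂ρ'
      ≤ (klDiv ρ π).toReal - ∫ θ, f θ ∂ρ + Real.log (∫ θ, Real.exp (f θ + g θ) ∂π) := by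
  have : IsProbabilityMeasure (π.tilted f) := isProbabilityMeasure_tilted hfπ
  have htop : klDiv ρ (π.tilted f) ≠ ∞ := klDiv_tilted_ne_top hfρ hfπ hkl
  have hgtilted : Integrable (fun θ => Real.exp (g θ)) (π.tilted f) := by
    refine (integrable_tilted_iff hfπ _).2 ?_
    simpa only [smul_eq_mul, Real.exp_add] using hfgπ
  have hlog : Real.log (∫ θ, Real.exp (g θ) ∂π.tilted f)
      = Real.log (∫ θ, Real.exp (f θ + g θ) ∂π) - Real.log (∫ θ, Real.exp (f θ) ∂π) := by
    rw [← Real.log_div (integral_exp_pos hfgπ).ne' (integral_exp_pos hfπ).ne']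
    exact congrArg Real.log (integral_exp_tilted f g)
  calc ∫ θ, g θ ∂ρ'
      ≤ (klDiv ρ' (π.tilted f)).toReal + Real.log (∫ θ, Real.exp (g θ) ∂π.tilted f) :=
        integral_le_toReal_klDiv_add_log_integral_exp hgρ' hgtilted (hmin.trans_lt htop.lt_top).ne
    _ ≤ (klDiv ρ (π.tilted f)).toReal + Real.log (∫ θ, Real.exp (g θ) ∂π.tilted f) := by
        gcongr
    _ = (klDiv ρ π).toReal - ∫ θ, f θ ∂ρ + Real.log (∫ θ, Real.exp (f θ + g θ) ∂π) := by
        rw [toReal_klDiv_tilted hfρ hfπ hkl, hlog]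
        ring

theorem lintegral_add_one_le_of_klDiv_tilted_le
    (hmin : klDiv ρ' (π.tilted f) ≤ klDiv ρ (π.tilted f)) (hfρ : Integrable f ρ)
    (hfπ : Integrable (fun θ => Real.exp (f θ)) π) (hg : Measurable g) (hg_nonneg : ∀ θ, 0 ≤ g θ)
    (hgρ' : Integrable g ρ') :
    ∫⁻ θ, ENNReal.ofReal (g θ) ∂ρ' + 1
      ≤ klDiv ρ π + ENNReal.ofReal (-∫ θ, f θ ∂ρ)
        + ∫⁻ θ, ENNReal.ofReal (Real.exp (f θ + g θ)) ∂π := by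
  obtain hkl | hkl := eq_or_ne (klDiv ρ π) ∞
  · simp [hkl]
  obtain hZ | hZ := eq_or_ne (∫⁻ θ, ENNReal.ofReal (Real.exp (f θ + g θ)) ∂π) ∞
  · simp [hZ]
  have hfgπ : Integrable (fun θ => Real.exp (f θ + g θ)) π := by
    refine ⟨?_, (hasFiniteIntegral_iff_ofReal (.of_forall fun _ => (Real.exp_pos _).le)).2
      hZ.lt_top⟩
    simp_rw [Real.exp_add]
    exact hfπ.1.mul hg.exp.aestronglyMeasurable
  have hbound := integral_le_of_klDiv_tilted_le hmin hkl hfρ hfπ hgρ' hfgπ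
  have hlog := Real.log_le_sub_one_of_pos (integral_exp_pos hfgπ)
  have hsum : ∫ θ, g θ ∂ρ' + 1
      ≤ (klDiv ρ π).toReal + -∫ θ, f θ ∂ρ + ∫ θ, Real.exp (f θ + g θ) ∂π := by linarith
  rw [← ofReal_integral_eq_lintegral_ofReal hgρ' (.of_forall hg_nonneg),
    ← ofReal_integral_eq_lintegral_ofReal hfgπ (.of_forall fun _ => (Real.exp_pos _).le),
    ← ENNReal.ofReal_one, ← ENNReal.ofReal_add (integral_nonneg hg_nonneg) zero_le_one]
  refine (ENNReal.ofReal_le_ofReal hsum).trans (ENNReal.ofReal_add_le.trans ?_)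
  gcongr
  exact ENNReal.ofReal_add_le.trans (by rw [ENNReal.ofReal_toReal hkl])

theorem lintegral_lintegral_le_klDiv_add {X : Type*} [MeasurableSpace X] {P : Measure X}
    [IsProbabilityMeasure P] {f : X → Θ → ℝ} {ρ' : X → Measure Θ}
    [∀ x, IsProbabilityMeasure (ρ' x)] {D : ℝ} (hf : Measurable (Function.uncurry f))
    (hg : Measurable g) (hg_nonneg : ∀ θ, 0 ≤ g θ)
    (hfπ : ∀ x, Integrable (fun θ => Real.exp (f x θ)) π) (hfρ : ∀ x, Integrable (f x) ρ)
    (hgρ' : ∀ x, Integrable g (ρ' x))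
    (hmoment : ∀ θ, ∫⁻ x, ENNReal.ofReal (Real.exp (f x θ + g θ)) ∂P ≤ 1)
    (hmin : ∀ x, klDiv (ρ' x) (π.tilted (f x)) ≤ klDiv ρ (π.tilted (f x)))
    (hD : ∀ x, -∫ θ, f x θ ∂ρ ≤ D) :
    ∫⁻ x, ∫⁻ θ, ENNReal.ofReal (g θ) ∂(ρ' x) ∂P ≤ klDiv ρ π + ENNReal.ofReal D := by
  have hmeas : Measurable fun z : X × Θ => ENNReal.ofReal (Real.exp (f z.1 z.2 + g z.2)) :=
    (hf.add (hg.comp measurable_snd)).exp.ennreal_ofReal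
  have hmoment_π : ∫⁻ x, ∫⁻ θ, ENNReal.ofReal (Real.exp (f x θ + g θ)) ∂π ∂P ≤ 1 := by
    rw [lintegral_lintegral_swap hmeas.aemeasurable]
    exact (lintegral_mono hmoment).trans_eq (by simp)
  refine ENNReal.le_of_add_le_add_right ENNReal.one_ne_top ?_
  calc ∫⁻ x, ∫⁻ θ, ENNReal.ofReal (g θ) ∂(ρ' x) ∂P + 1
      = ∫⁻ x, (∫⁻ θ, ENNReal.ofReal (g θ) ∂(ρ' x) + 1) ∂P := by
        rw [lintegral_add_right _ measurable_const, lintegral_one, measure_univ]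
    _ ≤ ∫⁻ x, (klDiv ρ π + ENNReal.ofReal D
          + ∫⁻ θ, ENNReal.ofReal (Real.exp (f x θ + g θ)) ∂π) ∂P := by
        refine lintegral_mono fun x => (lintegral_add_one_le_of_klDiv_tilted_le (hmin x) (hfρ x)
          (hfπ x) hg hg_nonneg (hgρ' x)).trans ?_
        gcongr
        exact hD x
    _ = klDiv ρ π + ENNReal.ofReal D
          + ∫⁻ x, ∫⁻ θ, ENNReal.ofReal (Real.exp (f x θ + g θ)) ∂π ∂P := by
        rw [lintegral_add_right _ hmeas.lintegral_prod_right', lintegral_const, measure_univ,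
          mul_one]
    _ ≤ klDiv ρ π + ENNReal.ofReal D + 1 := by gcongr

end VariationalInference

section KullbackLeibler

variable {α β : Type*} [MeasurableSpace α] [MeasurableSpace β]

theorem klDiv_eq_ofReal_integral_of_llr_ae_eq {μ ν : Measure α} [IsProbabilityMeasure μ]
    [IsProbabilityMeasure ν] {h : α → ℝ} (hac : μ ≪ ν) (hllr : llr μ ν =ᵐ[μ] h)
    (hh : Integrable h μ) : klDiv μ ν = ENNReal.ofReal (∫ x, h x ∂μ) := by
  have hint : Integrable (llr μ ν) μ := hh.congr hllr.symm
  rw [← ENNReal.ofReal_toReal (klDiv_ne_top hac hint),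
    toReal_klDiv_of_measure_eq hac (by simp), integral_congr_ae hllr]

theorem klDiv_eq_of_measurePreserving {μ ν : Measure α} {μ' ν' : Measure β} [IsFiniteMeasure μ]
    [IsFiniteMeasure ν] (e : α ≃ᵐ β) (hμ : MeasurePreserving e μ μ')
    (hν : MeasurePreserving e ν ν') : klDiv μ' ν' = klDiv μ ν := by
  rw [← hμ.map_eq, ← hν.map_eq]
  refine le_antisymm (klDiv_map_le μ ν e.measurable) ?_
  have h := klDiv_map_le (μ.map e) (ν.map e) e.symm.measurable
  rwa [e.map_symm_map, e.map_symm_map] at h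

theorem klDiv_prod (μ ν : Measure α) (μ' ν' : Measure β) [IsProbabilityMeasure μ]
    [IsProbabilityMeasure ν] [IsProbabilityMeasure μ'] [IsProbabilityMeasure ν'] :
    klDiv (μ.prod μ') (ν.prod ν') = klDiv μ ν + klDiv μ' ν' := by
  have hswap : klDiv (μ.prod μ') (μ.prod ν') = klDiv (μ'.prod μ) (ν'.prod μ) :=
    klDiv_eq_of_measurePreserving MeasurableEquiv.prodComm ⟨measurable_swap, Measure.prod_swap⟩
      ⟨measurable_swap, Measure.prod_swap⟩
  have hsnd : klDiv (μ.prod μ') (μ.prod ν') = klDiv μ' ν' := by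
    rw [hswap, ← Measure.compProd_const, ← Measure.compProd_const, klDiv_compProd_left]
  rw [← Measure.compProd_const, ← Measure.compProd_const, klDiv_compProd_eq_add,
    Measure.compProd_const, Measure.compProd_const, hsnd]

theorem klDiv_pi_fin : ∀ {n : ℕ} {α : Fin n → Type*} [∀ i, MeasurableSpace (α i)]
    (μ ν : ∀ i, Measure (α i)) [∀ i, IsProbabilityMeasure (μ i)] [∀ i, IsProbabilityMeasure (ν i)],
    klDiv (Measure.pi μ) (Measure.pi ν) = ∑ i, klDiv (μ i) (ν i)
  | 0, _, _, μ, ν, _, _ => by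
    rw [Measure.pi_of_empty μ, Measure.pi_of_empty ν, klDiv_self, Fin.sum_univ_zero]
  | n + 1, α, _, μ, ν, _, _ => by
    rw [← klDiv_eq_of_measurePreserving (MeasurableEquiv.piFinSuccAbove α 0)
      (measurePreserving_piFinSuccAbove μ 0) (measurePreserving_piFinSuccAbove ν 0), klDiv_prod,
      klDiv_pi_fin, Fin.sum_univ_succ]
    rfl

theorem klDiv_pi {ι : Type*} [Fintype ι] {α : ι → Type*} [∀ i, MeasurableSpace (α i)]
    (μ ν : ∀ i, Measure (α i)) [∀ i, IsProbabilityMeasure (μ i)]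
    [∀ i, IsProbabilityMeasure (ν i)] :
    klDiv (Measure.pi μ) (Measure.pi ν) = ∑ i, klDiv (μ i) (ν i) := by
  let e := (Fintype.equivFin ι).symm
  rw [klDiv_eq_of_measurePreserving (MeasurableEquiv.piCongrLeft α e)
    (measurePreserving_piCongrLeft μ e) (measurePreserving_piCongrLeft ν e), klDiv_pi_fin,
    e.sum_comp fun i => klDiv (μ i) (ν i)]

theorem klDiv_compProd_right_eq_lintegral [MeasurableSpace.CountableOrCountablyGenerated α β]
    {μ : Measure α} {κ η : Kernel α β} [IsFiniteMeasure μ] [IsMarkovKernel κ] [IsMarkovKernel η]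
    (hac : ∀ᵐ a ∂μ, κ a ≪ η a) : klDiv (μ ⊗ₘ κ) (μ ⊗ₘ η) = ∫⁻ a, klDiv (κ a) (η a) ∂μ := by
  have hκ : κ =ᵐ[μ] η.withDensity (κ.rnDeriv η) := by
    filter_upwards [hac] with a ha
    exact (Kernel.withDensity_rnDeriv_eq ha).symm
  have hdensity : μ ⊗ₘ κ = (μ ⊗ₘ η).withDensity fun z => κ.rnDeriv η z.1 z.2 := by
    rw [Measure.compProd_congr hκ]
    exact Measure.compProd_withDensity (Kernel.measurable_rnDeriv κ η)
  have hrnDeriv : (μ ⊗ₘ κ).rnDeriv (μ ⊗ₘ η) =ᵐ[μ ⊗ₘ η] fun z => κ.rnDeriv η z.1 z.2 := by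
    rw [hdensity]
    exact Measure.rnDeriv_withDensity _ (Kernel.measurable_rnDeriv κ η)
  have hmeas : Measurable fun z : α × β =>
      ENNReal.ofReal (klFun (κ.rnDeriv η z.1 z.2).toReal) :=
    (measurable_klFun.comp (Kernel.measurable_rnDeriv κ η).ennreal_toReal).ennreal_ofReal
  calc klDiv (μ ⊗ₘ κ) (μ ⊗ₘ η)
      = ∫⁻ z, ENNReal.ofReal (klFun (κ.rnDeriv η z.1 z.2).toReal) ∂(μ ⊗ₘ η) := by
        rw [klDiv_eq_lintegral_klFun_of_ac (.compProd_right hac)]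
        refine lintegral_congr_ae ?_
        filter_upwards [hrnDeriv] with z hz
        rw [hz]
    _ = ∫⁻ a, ∫⁻ b, ENNReal.ofReal (klFun (κ.rnDeriv η a b).toReal) ∂(η a) ∂μ :=
        Measure.lintegral_compProd hmeas
    _ = ∫⁻ a, klDiv (κ a) (η a) ∂μ := by
        refine lintegral_congr_ae ?_
        filter_upwards [hac] with a ha
        rw [klDiv_eq_lintegral_klFun_of_ac ha]
        refine lintegral_congr_ae ?_
        filter_upwards [Kernel.rnDeriv_eq_rnDeriv_measure (κ := κ) (η := η) (a := a)] with b hb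
        rw [hb]

theorem klDiv_cond {μ : Measure α} [IsProbabilityMeasure μ] {s : Set α} (hs : MeasurableSet s)
    (hμs : μ s ≠ 0) : klDiv (μ[|s]) μ = ENNReal.ofReal (-Real.log (μ.real s)) := by
  have := cond_isProbabilityMeasure hμs
  have hllr : llr (μ[|s]) μ =ᵐ[μ[|s]] fun _ => -Real.log (μ.real s) := by
    have hrn : (μ[|s]).rnDeriv μ =ᵐ[μ] (μ s)⁻¹ • s.indicator (μ.rnDeriv μ) :=
      (Measure.rnDeriv_smul_left_of_ne_top _ _ (ENNReal.inv_ne_top.2 hμs)).trans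
        (Filter.EventuallyEq.const_smul (Measure.rnDeriv_restrict μ μ hs) _)
    filter_upwards [cond_absolutelyContinuous.ae_le hrn,
      cond_absolutelyContinuous.ae_le (Measure.rnDeriv_self μ), ae_cond_mem hs] with x hx hx1 hxs
    simp [llr_def, hx, hxs, hx1, measureReal_def, Real.log_inv]
  rw [klDiv_eq_ofReal_integral_of_llr_ae_eq cond_absolutelyContinuous hllr (integrable_const _)]
  simp

theorem integral_sub_sq_eq_variance_add {μ : Measure α} [IsProbabilityMeasure μ] {X : α → ℝ}
    (hX : MemLp X 2 μ) (c : ℝ) : ∫ a, (X a - c) ^ 2 ∂μ = Var[X; μ] + (μ[X] - c) ^ 2 := by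
  have h := variance_eq_sub (X := fun a => X a - c) (hX.sub (memLp_const c))
  rw [variance_sub_const hX.1, integral_sub (hX.integrable one_le_two) (integrable_const c),
    integral_const, probReal_univ, one_smul] at h
  exact eq_add_of_sub_eq h.symm

theorem log_gaussianPDFReal (c : ℝ) {v : ℝ≥0} (hv : v ≠ 0) (x : ℝ) :
    Real.log (gaussianPDFReal c v x)
      = -Real.log (2 * Real.pi * v) / 2 - (x - c) ^ 2 / (2 * v) := by
  have : (0 : ℝ) < v := NNReal.coe_pos.2 hv.bot_lt
  rw [gaussianPDFReal, Real.log_mul (by positivity) (Real.exp_pos _).ne', Real.log_exp,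
    Real.log_inv, Real.log_sqrt (by positivity)]
  ring

theorem llr_gaussianReal_ae_eq (c c' : ℝ) {v w : ℝ≥0} (hv : v ≠ 0) (hw : w ≠ 0) :
    llr (gaussianReal c v) (gaussianReal c' w) =ᵐ[gaussianReal c v] fun x =>
      Real.log (w / v) / 2 + ((x - c') ^ 2 / (2 * w) - (x - c) ^ 2 / (2 * v)) := by
  have hv_pos : (0 : ℝ) < v := NNReal.coe_pos.2 hv.bot_lt
  have hw_pos : (0 : ℝ) < w := NNReal.coe_pos.2 hw.bot_lt
  have hvol := gaussianReal_absolutelyContinuous c hv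
  have hvol' := gaussianReal_absolutelyContinuous' c' hw
  filter_upwards [hvol.ae_le (rnDeriv_gaussianReal c v), hvol.ae_le (rnDeriv_gaussianReal c' w),
    (hvol.trans hvol').ae_le
      (Measure.rnDeriv_eq_div hvol (gaussianReal_absolutelyContinuous c' hw))] with x hx hx' hdiv
  have hquot : Real.log (gaussianPDFReal c v x / gaussianPDFReal c' w x)
      = Real.log (w / v) / 2 + ((x - c') ^ 2 / (2 * w) - (x - c) ^ 2 / (2 * v)) := by
    rw [Real.log_div (gaussianPDFReal_pos _ _ _ hv).ne' (gaussianPDFReal_pos _ _ _ hw).ne',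
      log_gaussianPDFReal c hv, log_gaussianPDFReal c' hw, Real.log_div hw_pos.ne' hv_pos.ne',
      Real.log_mul (by positivity) hv_pos.ne', Real.log_mul (by positivity) hw_pos.ne']
    ring
  simpa only [llr_def, hdiv, hx, hx', ENNReal.toReal_div, toReal_gaussianPDF] using hquot

theorem integral_sub_sq_gaussianReal (c t : ℝ) (v : ℝ≥0) :
    ∫ x, (x - t) ^ 2 ∂gaussianReal c v = v + (c - t) ^ 2 := by
  have h := integral_sub_sq_eq_variance_add (memLp_id_gaussianReal (μ := c) (v := v) 2) t
  simpa only [id_eq, variance_id_gaussianReal, integral_id_gaussianReal] using h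

theorem klDiv_gaussianReal (c c' : ℝ) {v w : ℝ≥0} (hv : v ≠ 0) (hw : w ≠ 0) :
    klDiv (gaussianReal c v) (gaussianReal c' w)
      = ENNReal.ofReal ((Real.log (w / v) + (v + (c - c') ^ 2) / w - 1) / 2) := by
  have : (0 : ℝ) < v := NNReal.coe_pos.2 hv.bot_lt
  have hsq : ∀ t d, Integrable (fun x => (x - t) ^ 2 / d) (gaussianReal c v) := fun t d =>
    ((memLp_id_gaussianReal 2).sub (memLp_const t)).integrable_sq.div_const d
  have hdiff : Integrable (fun x => (x - c') ^ 2 / (2 * w) - (x - c) ^ 2 / (2 * v))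
      (gaussianReal c v) := (hsq c' _).sub (hsq c _)
  have hac := (gaussianReal_absolutelyContinuous c hv).trans
    (gaussianReal_absolutelyContinuous' c' hw)
  rw [klDiv_eq_ofReal_integral_of_llr_ae_eq hac (llr_gaussianReal_ae_eq c c' hv hw)
      ((integrable_const _).add hdiff),
    integral_add (integrable_const _) hdiff, integral_sub (hsq c' _) (hsq c _),
    integral_const, probReal_univ, one_smul, integral_div, integral_div,
    integral_sub_sq_gaussianReal, integral_sub_sq_gaussianReal]
  congr 1
  field_simp
  ring

end KullbackLeibler

section InverseGamma

theorem le_gammaMeasure_real_Icc {a b s t : ℝ} (ha : 0 < a) (hb : 0 < b) (hs : 0 < s)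
    (hst : s ≤ t) :
    (t - s) / t * (b * s) ^ a * Real.exp (-(b * t)) / Real.Gamma a
      ≤ (gammaMeasure a b).real (Set.Icc s t) := by
  have hprob := isProbabilityMeasure_gammaMeasure ha hb
  have ht : 0 < t := hs.trans_le hst
  have := Real.Gamma_pos_of_pos ha
  rw [measureReal_def, ← ENNReal.ofReal_le_iff_le_toReal (measure_ne_top _ _), gammaMeasure,
    withDensity_apply _ measurableSet_Icc]
  calc ENNReal.ofReal ((t - s) / t * (b * s) ^ a * Real.exp (-(b * t)) / Real.Gamma a)
      = ∫⁻ _ in Set.Icc s t,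
          ENNReal.ofReal (b ^ a / Real.Gamma a * (s ^ a / t) * Real.exp (-(b * t))) := by
        rw [setLIntegral_const, Real.volume_Icc, ← ENNReal.ofReal_mul (by positivity),
          Real.mul_rpow hb.le hs.le]
        congr 1
        ring
    _ ≤ ∫⁻ x in Set.Icc s t, gammaPDF a b x := by
        refine setLIntegral_mono' measurableSet_Icc fun x hx => ?_
        have hx_pos : 0 < x := hs.trans_le hx.1
        rw [gammaPDF_of_nonneg hx_pos.le, Real.rpow_sub_one hx_pos.ne']
        gcongr
        exacts [hx.1, hx.2, hx.2]

theorem isProbabilityMeasure_invGammaMeasure {a b : ℝ} (ha : 0 < a) (hb : 0 < b) :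
    IsProbabilityMeasure (invGammaMeasure a b) :=
  have := isProbabilityMeasure_gammaMeasure ha hb
  Measure.isProbabilityMeasure_map measurable_inv.aemeasurable

variable {a b lo hi : ℝ}

theorem le_invGammaMeasure_real_Icc (ha : 0 < a) (hb : 0 < b) (hlo : 0 < lo) (hle : lo ≤ hi) :
    (hi - lo) / hi * (b / hi) ^ a * Real.exp (-(b / lo)) / Real.Gamma a
      ≤ (invGammaMeasure a b).real (Set.Icc lo hi) := by
  have hhi : 0 < hi := hlo.trans_le hle
  have hprob := isProbabilityMeasure_gammaMeasure ha hb
  have hfactor : (lo⁻¹ - hi⁻¹) / lo⁻¹ = (hi - lo) / hi := by field_simp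
  calc (hi - lo) / hi * (b / hi) ^ a * Real.exp (-(b / lo)) / Real.Gamma a
      ≤ (gammaMeasure a b).real (Set.Icc hi⁻¹ lo⁻¹) := by
        rw [← hfactor, div_eq_mul_inv b, div_eq_mul_inv b]
        exact le_gammaMeasure_real_Icc ha hb (inv_pos.2 hhi) ((inv_le_inv₀ hhi hlo).2 hle)
    _ ≤ (invGammaMeasure a b).real (Set.Icc lo hi) := by
        rw [invGammaMeasure, map_measureReal_apply measurable_inv measurableSet_Icc]
        refine measureReal_mono (fun x hx => ?_) (measure_ne_top _ _)
        have hx_pos : 0 < x := (inv_pos.2 hhi).trans_le hx.1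
        exact ⟨(le_inv_comm₀ hlo hx_pos).2 hx.2, (inv_le_comm₀ hx_pos hhi).2 hx.1⟩

theorem invGammaMeasure_Icc_ne_zero (ha : 0 < a) (hb : 0 < b) (hlo : 0 < lo) (hlt : lo < hi) :
    invGammaMeasure a b (Set.Icc lo hi) ≠ 0 := by
  intro h0
  have hhi : 0 < hi := hlo.trans hlt
  have : 0 < hi - lo := sub_pos.2 hlt
  have := Real.Gamma_pos_of_pos ha
  have hle := le_invGammaMeasure_real_Icc ha hb hlo hlt.le
  rw [measureReal_def, h0, ENNReal.toReal_zero] at hle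
  exact hle.not_gt (by positivity)

theorem neg_log_invGammaMeasure_real_Icc_le (ha : 0 < a) (hb : 0 < b) (hlo : 0 < lo)
    (hlt : lo < hi) :
    -Real.log ((invGammaMeasure a b).real (Set.Icc lo hi))
      ≤ Real.log (hi / (hi - lo)) + a * Real.log (hi / b) + b / lo
        + Real.log (Real.Gamma a) := by
  have hhi : 0 < hi := hlo.trans hlt
  have : 0 < hi - lo := sub_pos.2 hlt
  have hΓ := Real.Gamma_pos_of_pos ha
  have hlog := Real.log_le_log (by positivity) (le_invGammaMeasure_real_Icc ha hb hlo hlt.le)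
  rw [Real.log_div (by positivity) hΓ.ne', Real.log_mul (by positivity) (by positivity),
    Real.log_mul (by positivity) (by positivity), Real.log_exp, Real.log_rpow (by positivity),
    ← inv_div hi (hi - lo), ← inv_div hi b, Real.log_inv, Real.log_inv] at hlog
  linarith

theorem neg_two_add_log_two_le_log_Gamma (ha : 0 < a) :
    -(2 + Real.log 2) ≤ Real.log (Real.Gamma a) := by
  have hprob := isProbabilityMeasure_gammaMeasure ha one_pos
  have hle := (le_gammaMeasure_real_Icc ha one_pos one_pos one_le_two).trans
    (measureReal_le_one (μ := gammaMeasure a 1))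
  rw [div_le_one (Real.Gamma_pos_of_pos ha)] at hle
  norm_num at hle
  calc -(2 + Real.log 2) = Real.log (1 / 2 * Real.exp (-2)) := by
        rw [Real.log_mul (by norm_num) (Real.exp_pos _).ne', Real.log_exp, one_div, Real.log_inv]
        ring
    _ ≤ Real.log (Real.Gamma a) := Real.log_le_log (by positivity) hle

end InverseGamma

section ReferenceLaw

variable {d m p K : ℕ}

/-- The law of a `d × K` matrix with independent Gaussian entries, the entry `(i, k)` having mean
`c i k` and variance `v k`. -/
noncomputable def gaussianMatrixLaw (c : Fin d → Fin K → ℝ) (v : Fin K → ℝ≥0) :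
    Measure (Fin d → Fin K → ℝ) :=
  Measure.pi fun i => Measure.pi fun k => gaussianReal (c i k) (v k)

instance (c : Fin d → Fin K → ℝ) (v : Fin K → ℝ≥0) :
    IsProbabilityMeasure (gaussianMatrixLaw c v) := by
  unfold gaussianMatrixLaw; infer_instance

instance : IsMarkovKernel (gaussianRows d K) :=
  ⟨fun γ => inferInstanceAs
    (IsProbabilityMeasure (gaussianMatrixLaw 0 fun k => Real.toNNReal (γ k)))⟩

theorem isProbabilityMeasure_prior {a b : ℝ} (ha : 0 < a) (hb : 0 < b) :
    IsProbabilityMeasure (prior m p K a b) := by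
  have := isProbabilityMeasure_invGammaMeasure ha hb
  unfold prior; infer_instance

/-- The comparison laws of the mean-field family: independent variances `γ k` of law `τ k`, and
independent Gaussian entries, centred at the given factors `U` and `V`, whose variance `v k`
depends on the column only. -/
noncomputable def refLaw (τ : Fin K → Measure ℝ) (U : Fin m → Fin K → ℝ)
    (V : Fin p → Fin K → ℝ) (v : Fin K → ℝ≥0) : Measure (Param m p K) :=
  (Measure.pi τ).prod ((gaussianMatrixLaw U v).prod (gaussianMatrixLaw V v))

/-- An upper bound for the divergence of `N(x, v)` from `N(0, γ)`, uniform over `|x| ≤ c` and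
`lo ≤ γ ≤ hi`. -/
noncomputable def entryCost (lo hi v c : ℝ) : ℝ :=
  (Real.log (hi / v) + (v + c ^ 2) / lo - 1) / 2

theorem entryCost_nonneg {lo hi v : ℝ} (c : ℝ) (hlo : 0 < lo) (hle : lo ≤ hi) (hv : 0 < v) :
    0 ≤ entryCost lo hi v c := by
  have hhi : 0 < hi := hlo.trans_le hle
  have hlog := Real.one_sub_inv_le_log_of_pos (div_pos hhi hv)
  have hquot : v / hi ≤ (v + c ^ 2) / lo :=
    div_le_div₀ (by positivity) (le_add_of_nonneg_right (sq_nonneg c)) hlo hle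
  rw [inv_div] at hlog
  unfold entryCost
  linarith

theorem klDiv_gaussianReal_le_entryCost {lo hi γ x c : ℝ} {v : ℝ≥0} (hlo : 0 < lo)
    (hγ : γ ∈ Set.Icc lo hi) (hv : v ≠ 0) (hx : |x| ≤ c) :
    klDiv (gaussianReal x v) (gaussianReal 0 γ.toNNReal)
      ≤ ENNReal.ofReal (entryCost lo hi v c) := by
  have hγ_pos : 0 < γ := hlo.trans_le hγ.1
  have : (0 : ℝ) < v := NNReal.coe_pos.2 hv.bot_lt
  have hsq : x ^ 2 ≤ c ^ 2 := sq_le_sq.2 (hx.trans (le_abs_self c))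
  rw [klDiv_gaussianReal x 0 hv (Real.toNNReal_pos.2 hγ_pos).ne', sub_zero,
    Real.coe_toNNReal _ hγ_pos.le, entryCost]
  gcongr
  exacts [hγ.2, hγ.1]

theorem klDiv_gaussianMatrixLaw_le {lo hi γ c : Fin K → ℝ} {v : Fin K → ℝ≥0}
    (hlo : ∀ k, 0 < lo k) (hγ : ∀ k, γ k ∈ Set.Icc (lo k) (hi k)) (hv : ∀ k, v k ≠ 0)
    {U : Fin d → Fin K → ℝ} (hU : ∀ i k, |U i k| ≤ c k) :
    klDiv (gaussianMatrixLaw U v) (gaussianRows d K γ)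
      ≤ d * ∑ k, ENNReal.ofReal (entryCost (lo k) (hi k) (v k) (c k)) := by
  change klDiv (gaussianMatrixLaw U v) (gaussianMatrixLaw 0 fun k => Real.toNNReal (γ k)) ≤ _
  simp only [gaussianMatrixLaw, klDiv_pi]
  calc _ ≤ ∑ _ : Fin d, ∑ k, ENNReal.ofReal (entryCost (lo k) (hi k) (v k) (c k)) :=
        Finset.sum_le_sum fun i _ => Finset.sum_le_sum fun k _ =>
          klDiv_gaussianReal_le_entryCost (hlo k) (hγ k) (hv k) (hU i k)
    _ = _ := by rw [Finset.sum_const, Finset.card_univ, Fintype.card_fin, nsmul_eq_mul]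

theorem klDiv_refLaw_le {a b : ℝ} (ha : 0 < a) (hb : 0 < b) {τ : Fin K → Measure ℝ}
    [∀ k, IsProbabilityMeasure (τ k)] {lo hi c : Fin K → ℝ} {v : Fin K → ℝ≥0}
    (hlo : ∀ k, 0 < lo k) (hτ : ∀ k, ∀ᵐ γ ∂τ k, γ ∈ Set.Icc (lo k) (hi k))
    (hv : ∀ k, v k ≠ 0) {U : Fin m → Fin K → ℝ} {V : Fin p → Fin K → ℝ}
    (hU : ∀ i k, |U i k| ≤ c k) (hV : ∀ j k, |V j k| ≤ c k) :
    klDiv (refLaw τ U V v) (prior m p K a b)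
      ≤ ∑ k, klDiv (τ k) (invGammaMeasure a b)
        + (m + p) * ∑ k, ENNReal.ofReal (entryCost (lo k) (hi k) (v k) (c k)) := by
  have := isProbabilityMeasure_invGammaMeasure ha hb
  set G := (gaussianMatrixLaw U v).prod (gaussianMatrixLaw V v)
  set cost := ∑ k, ENNReal.ofReal (entryCost (lo k) (hi k) (v k) (c k))
  have hrows : ∀ᵐ γ ∂Measure.pi τ,
      klDiv G ((gaussianRows m K ×ₖ gaussianRows p K) γ) ≤ (m + p) * cost := by
    filter_upwards [ae_all_iff.2 fun k =>
      (measurePreserving_eval τ k).quasiMeasurePreserving.ae (hτ k)] with γ hγ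
    rw [Kernel.prod_apply, klDiv_prod, add_mul]
    exact add_le_add (klDiv_gaussianMatrixLaw_le hlo hγ hv hU)
      (klDiv_gaussianMatrixLaw_le hlo hγ hv hV)
  have hfinite : (m + p) * cost ≠ ∞ :=
    ENNReal.mul_ne_top (by finiteness) (ENNReal.sum_ne_top.2 fun _ _ => ENNReal.ofReal_ne_top)
  have hac : ∀ᵐ γ ∂Measure.pi τ,
      Kernel.const _ G γ ≪ (gaussianRows m K ×ₖ gaussianRows p K) γ := by
    filter_upwards [hrows] with γ hγ
    exact (klDiv_ne_top_iff.1 (ne_top_of_le_ne_top hfinite hγ)).1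
  rw [refLaw, prior, ← Measure.compProd_const, klDiv_compProd_eq_add, klDiv_pi,
    klDiv_compProd_right_eq_lintegral hac]
  gcongr
  calc ∫⁻ γ, klDiv G ((gaussianRows m K ×ₖ gaussianRows p K) γ) ∂Measure.pi τ
      ≤ ∫⁻ _, (m + p) * cost ∂Measure.pi τ := lintegral_mono_ae hrows
    _ = (m + p) * cost := by rw [lintegral_const, measure_univ, mul_one]

theorem klDiv_refLaw_cond_le {a b : ℝ} (ha : 0 < a) (hb : 0 < b) {lo hi c : Fin K → ℝ}
    {v : Fin K → ℝ≥0} (hlo : ∀ k, 0 < lo k) (hlt : ∀ k, lo k < hi k) (hv : ∀ k, v k ≠ 0)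
    {U : Fin m → Fin K → ℝ} {V : Fin p → Fin K → ℝ}
    (hU : ∀ i k, |U i k| ≤ c k) (hV : ∀ j k, |V j k| ≤ c k) :
    klDiv (refLaw (fun k => (invGammaMeasure a b)[|Set.Icc (lo k) (hi k)]) U V v)
        (prior m p K a b)
      ≤ ENNReal.ofReal (∑ k, (-Real.log ((invGammaMeasure a b).real (Set.Icc (lo k) (hi k)))
        + (m + p) * entryCost (lo k) (hi k) (v k) (c k))) := by
  have := isProbabilityMeasure_invGammaMeasure ha hb
  have hmass := fun k => invGammaMeasure_Icc_ne_zero ha hb (hlo k) (hlt k)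
  have := fun k => cond_isProbabilityMeasure (hmass k)
  have hcost : ∀ k, 0 ≤ entryCost (lo k) (hi k) (v k) (c k) := fun k =>
    entryCost_nonneg _ (hlo k) (hlt k).le (NNReal.coe_pos.2 (hv k).bot_lt)
  have hlog : ∀ k, 0 ≤ -Real.log ((invGammaMeasure a b).real (Set.Icc (lo k) (hi k))) := fun k =>
    neg_nonneg.2 (Real.log_nonpos measureReal_nonneg measureReal_le_one)
  refine (klDiv_refLaw_le ha hb hlo (fun k => ae_cond_mem measurableSet_Icc) hv hU hV).trans_eq ?_
  simp only [klDiv_cond measurableSet_Icc (hmass _)]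
  rw [Finset.sum_add_distrib, ← Finset.mul_sum,
    ENNReal.ofReal_add (Finset.sum_nonneg fun k _ => hlog k)
      (mul_nonneg (by positivity) (Finset.sum_nonneg fun k _ => hcost k)),
    ENNReal.ofReal_mul (by positivity), ENNReal.ofReal_sum_of_nonneg fun k _ => hlog k,
    ENNReal.ofReal_sum_of_nonneg fun k _ => hcost k, ENNReal.ofReal_add (by positivity)
      (by positivity), ENNReal.ofReal_natCast, ENNReal.ofReal_natCast]

end ReferenceLaw

section Moments

variable {m p K : ℕ}

theorem toMatrix_apply (θ : Param m p K) (i : Fin m) (j : Fin p) :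
    θ.toMatrix i j = ∑ k, θ.2.1 i k * θ.2.2 j k := by
  simp [Param.toMatrix, Matrix.mul_apply]

theorem measurable_toMatrix_apply (i : Fin m) (j : Fin p) :
    Measurable fun θ : Param m p K => θ.toMatrix i j := by
  simp only [toMatrix_apply]
  fun_prop

theorem memLp_mul_gaussianReal_prod (x y : ℝ) (v : ℝ≥0) :
    MemLp (fun z : ℝ × ℝ => z.1 * z.2) 2 ((gaussianReal x v).prod (gaussianReal y v)) := by
  refine (memLp_two_iff_integrable_sq (by fun_prop)).2 ?_
  simp only [mul_pow]
  exact (memLp_id_gaussianReal 2).integrable_sq.mul_prod (memLp_id_gaussianReal 2).integrable_sq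

theorem integral_mul_gaussianReal_prod (x y : ℝ) (v : ℝ≥0) :
    ∫ z, z.1 * z.2 ∂(gaussianReal x v).prod (gaussianReal y v) = x * y := by
  rw [integral_prod_mul (fun s => s) (fun t => t), integral_id_gaussianReal,
    integral_id_gaussianReal]

theorem variance_mul_gaussianReal_prod (x y : ℝ) (v : ℝ≥0) :
    Var[fun z : ℝ × ℝ => z.1 * z.2; (gaussianReal x v).prod (gaussianReal y v)]
      = v ^ 2 + v * (x ^ 2 + y ^ 2) := by
  have hsq : ∀ t, ∫ s, s ^ 2 ∂gaussianReal t v = v + t ^ 2 := fun t => by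
    simpa using integral_sub_sq_gaussianReal t 0 v
  rw [variance_eq_sub (memLp_mul_gaussianReal_prod x y v), integral_mul_gaussianReal_prod]
  simp only [Pi.pow_apply, mul_pow]
  rw [integral_prod_mul (fun s => s ^ 2) (fun t => t ^ 2), hsq, hsq]
  ring

variable (τ : Fin K → Measure ℝ) [∀ k, IsProbabilityMeasure (τ k)] (U : Fin m → Fin K → ℝ)
  (V : Fin p → Fin K → ℝ) (v : Fin K → ℝ≥0)

instance : IsProbabilityMeasure (refLaw τ U V v) := by
  unfold refLaw; infer_instance

theorem refLaw_mem_meanField : refLaw τ U V v ∈ meanField m p K :=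
  ⟨_, _, τ, fun _ => inferInstance, fun _ => inferInstance, inferInstance, rfl⟩

theorem measurePreserving_rows_refLaw (i : Fin m) (j : Fin p) :
    MeasurePreserving (fun (θ : Param m p K) k => (θ.2.1 i k, θ.2.2 j k)) (refLaw τ U V v)
      (Measure.pi fun k => (gaussianReal (U i k) (v k)).prod (gaussianReal (V j k) (v k))) :=
  (measurePreserving_arrowProdEquivProdArrow ℝ ℝ (Fin K) (fun k => gaussianReal (U i k) (v k))
    (fun k => gaussianReal (V j k) (v k))).symm.comp <|
    ((measurePreserving_eval (fun i => Measure.pi fun k => gaussianReal (U i k) (v k)) i).prod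
      (measurePreserving_eval (fun j => Measure.pi fun k => gaussianReal (V j k) (v k)) j)).comp
      measurePreserving_snd

theorem measurePreserving_entries_refLaw (i : Fin m) (j : Fin p) (k : Fin K) :
    MeasurePreserving (fun θ : Param m p K => (θ.2.1 i k, θ.2.2 j k)) (refLaw τ U V v)
      ((gaussianReal (U i k) (v k)).prod (gaussianReal (V j k) (v k))) :=
  (measurePreserving_eval
    (fun k => (gaussianReal (U i k) (v k)).prod (gaussianReal (V j k) (v k))) k).comp
    (measurePreserving_rows_refLaw τ U V v i j)

theorem memLp_toMatrix_apply (i : Fin m) (j : Fin p) :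
    MemLp (fun θ : Param m p K => θ.toMatrix i j) 2 (refLaw τ U V v) := by
  simp only [toMatrix_apply]
  exact memLp_finsetSum _ fun k _ => (memLp_mul_gaussianReal_prod _ _ _).comp_measurePreserving
    (measurePreserving_entries_refLaw τ U V v i j k)

theorem integral_toMatrix_apply (i : Fin m) (j : Fin p) :
    ∫ θ, θ.toMatrix i j ∂refLaw τ U V v = ∑ k, U i k * V j k := by
  have hentry := measurePreserving_entries_refLaw τ U V v i j
  have hint : ∀ k, Integrable (fun θ : Param m p K => θ.2.1 i k * θ.2.2 j k) (refLaw τ U V v) :=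
    fun k => ((memLp_mul_gaussianReal_prod _ _ _).comp_measurePreserving
      (hentry k)).integrable one_le_two
  simp only [toMatrix_apply]
  rw [integral_finsetSum _ fun k _ => hint k]
  refine Finset.sum_congr rfl fun k _ => ?_
  rw [← integral_mul_gaussianReal_prod (U i k) (V j k) (v k), ← (hentry k).map_eq,
    integral_map (hentry k).aemeasurable (by fun_prop)]

theorem variance_toMatrix_apply (i : Fin m) (j : Fin p) :
    Var[fun θ : Param m p K => θ.toMatrix i j; refLaw τ U V v]
      = ∑ k, ((v k : ℝ) ^ 2 + v k * (U i k ^ 2 + V j k ^ 2)) := by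
  have hsum := variance_sum_pi (X := fun _ (z : ℝ × ℝ) => z.1 * z.2)
    fun k => memLp_mul_gaussianReal_prod (U i k) (V j k) (v k)
  simp only [variance_mul_gaussianReal_prod] at hsum
  rw [← hsum, ← (measurePreserving_rows_refLaw τ U V v i j).variance_fun_comp (by fun_prop)]
  simp only [toMatrix_apply, Finset.sum_apply]

theorem integral_toMatrix_apply_sub_sq (i : Fin m) (j : Fin p) :
    ∫ θ, (θ.toMatrix i j - ∑ k, U i k * V j k) ^ 2 ∂refLaw τ U V v
      = ∑ k, ((v k : ℝ) ^ 2 + v k * (U i k ^ 2 + V j k ^ 2)) := by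
  rw [integral_sub_sq_eq_variance_add (memLp_toMatrix_apply τ U V v i j),
    integral_toMatrix_apply, sub_self, variance_toMatrix_apply]
  ring

end Moments

section Likelihood

variable {m p n K : ℕ} {σ : ℝ}

/-- The log-likelihood ratio of `M` against `M₀` at one observation. -/
noncomputable def obsLogRatio (σ : ℝ) (M M₀ : Matrix (Fin m) (Fin p) ℝ) (o : Obs m p) : ℝ :=
  ((o.2 - M₀ o.1.1 o.1.2) ^ 2 - (o.2 - M o.1.1 o.1.2) ^ 2) / (2 * σ ^ 2)

/-- The log-likelihood ratio of `M` against `M₀` at a sample. -/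
noncomputable def logLikelihoodRatio (σ : ℝ) (M M₀ : Matrix (Fin m) (Fin p) ℝ)
    (x : Fin n → Obs m p) : ℝ :=
  ∑ k, obsLogRatio σ M M₀ (x k)

theorem logLikelihood_eq_add (hσ : σ ≠ 0) (M M₀ : Matrix (Fin m) (Fin p) ℝ)
    (x : Fin n → Obs m p) :
    logLikelihood σ x M = logLikelihood σ x M₀ + logLikelihoodRatio σ M M₀ x := by
  have hv : (σ ^ 2).toNNReal ≠ 0 := (Real.toNNReal_pos.2 (by positivity)).ne'
  simp only [logLikelihood, logLikelihoodRatio, obsLogRatio, log_gaussianPDFReal _ hv,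
    Real.coe_toNNReal _ (sq_nonneg σ), ← Finset.sum_add_distrib]
  exact Finset.sum_congr rfl fun k _ => by ring

theorem tilted_const_add {Ω : Type*} [MeasurableSpace Ω] (μ : Measure Ω) (c : ℝ) (f : Ω → ℝ) :
    μ.tilted (fun ω => c + f ω) = μ.tilted f := by
  simp only [Measure.tilted, Real.exp_add, integral_const_mul,
    mul_div_mul_left _ _ (Real.exp_pos c).ne']

theorem fracPosterior_eq_tilted (hσ : σ ≠ 0) (a b α : ℝ) (M₀ : Matrix (Fin m) (Fin p) ℝ)
    (x : Fin n → Obs m p) :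
    fracPosterior K a b σ α x
      = (prior m p K a b).tilted fun θ => α * logLikelihoodRatio σ θ.toMatrix M₀ x := by
  rw [fracPosterior, ← tilted_const_add _ (α * logLikelihood σ x M₀)
    fun θ : Param m p K => α * logLikelihoodRatio σ θ.toMatrix M₀ x]
  congr 1 with θ
  rw [logLikelihood_eq_add hσ _ M₀, mul_add]

theorem measurable_obsLogRatio {Ω : Type*} [MeasurableSpace Ω] {o : Ω → Obs m p}
    {M : Ω → Matrix (Fin m) (Fin p) ℝ} (ho : Measurable o)
    (hM : ∀ i j, Measurable fun ω => M ω i j) (M₀ : Matrix (Fin m) (Fin p) ℝ) :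
    Measurable fun ω => obsLogRatio σ (M ω) M₀ (o ω) := by
  have h_entry : Measurable fun w : (Fin m × Fin p) × Ω => M w.2 w.1.1 w.1.2 :=
    measurable_from_prod_countable_right fun z => hM z.1 z.2
  have h_entry₀ : Measurable fun z : Fin m × Fin p => M₀ z.1 z.2 := measurable_of_countable _
  exact (((ho.snd.sub (h_entry₀.comp ho.fst)).pow_const 2).sub
    ((ho.snd.sub (h_entry.comp (ho.fst.prodMk measurable_id))).pow_const 2)).div_const _

theorem measurable_logLikelihoodRatio {Ω : Type*} [MeasurableSpace Ω] {x : Ω → Fin n → Obs m p}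
    {M : Ω → Matrix (Fin m) (Fin p) ℝ} (hx : Measurable x)
    (hM : ∀ i j, Measurable fun ω => M ω i j) (M₀ : Matrix (Fin m) (Fin p) ℝ) :
    Measurable fun ω => logLikelihoodRatio σ (M ω) M₀ (x ω) :=
  Finset.measurable_sum _ fun k _ =>
    measurable_obsLogRatio ((measurable_pi_apply k).comp hx) hM M₀

theorem logLikelihoodRatio_le (σ : ℝ) (M M₀ : Matrix (Fin m) (Fin p) ℝ) (x : Fin n → Obs m p) :
    logLikelihoodRatio σ M M₀ x ≤ ∑ k, ((x k).2 - M₀ (x k).1.1 (x k).1.2) ^ 2 / (2 * σ ^ 2) := by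
  refine Finset.sum_le_sum fun k _ => ?_
  unfold obsLogRatio
  gcongr
  exact sub_le_self _ (sq_nonneg _)

theorem integrable_exp_logLikelihoodRatio {Θ : Type*} [MeasurableSpace Θ] (π : Measure Θ)
    [IsFiniteMeasure π] {α : ℝ} (hα : 0 ≤ α) {M : Θ → Matrix (Fin m) (Fin p) ℝ}
    (hM : ∀ i j, Measurable fun θ => M θ i j) (M₀ : Matrix (Fin m) (Fin p) ℝ)
    (x : Fin n → Obs m p) :
    Integrable (fun θ => Real.exp (α * logLikelihoodRatio σ (M θ) M₀ x)) π := by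
  have h_meas : Measurable fun θ => logLikelihoodRatio σ (M θ) M₀ x :=
    measurable_logLikelihoodRatio measurable_const hM M₀
  refine .of_bound (h_meas.const_mul α).exp.aestronglyMeasurable (Real.exp
    (α * ∑ k, ((x k).2 - M₀ (x k).1.1 (x k).1.2) ^ 2 / (2 * σ ^ 2))) (.of_forall fun θ => ?_)
  rw [Real.norm_eq_abs, Real.abs_exp]
  gcongr
  exact logLikelihoodRatio_le σ (M θ) M₀ x

section Unbiased

variable {Θ : Type*} [MeasurableSpace Θ] {ρ : Measure Θ} [IsProbabilityMeasure ρ]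
  {M : Θ → Matrix (Fin m) (Fin p) ℝ} {M₀ : Matrix (Fin m) (Fin p) ℝ}

theorem integrable_obsLogRatio (hM : ∀ i j, MemLp (fun θ => M θ i j) 2 ρ) (o : Obs m p) :
    Integrable (fun θ => obsLogRatio σ (M θ) M₀ o) ρ :=
  ((integrable_const _).sub
    ((memLp_const o.2).sub (hM o.1.1 o.1.2)).integrable_sq).div_const _

theorem integrable_logLikelihoodRatio (hM : ∀ i j, MemLp (fun θ => M θ i j) 2 ρ)
    (x : Fin n → Obs m p) : Integrable (fun θ => logLikelihoodRatio σ (M θ) M₀ x) ρ :=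
  integrable_finsetSum _ fun k _ => integrable_obsLogRatio hM (x k)

theorem neg_integral_logLikelihoodRatio (hM : ∀ i j, MemLp (fun θ => M θ i j) 2 ρ)
    (hmean : ∀ i j, ∫ θ, M θ i j ∂ρ = M₀ i j) (x : Fin n → Obs m p) :
    -∫ θ, logLikelihoodRatio σ (M θ) M₀ x ∂ρ
      = ∑ k, (∫ θ, (M θ (x k).1.1 (x k).1.2 - M₀ (x k).1.1 (x k).1.2) ^ 2 ∂ρ) / (2 * σ ^ 2) := by
  have h_sq (k : Fin n) :
      Integrable (fun θ => ((x k).2 - M θ (x k).1.1 (x k).1.2) ^ 2) ρ :=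
    ((memLp_const (x k).2).sub (hM _ _)).integrable_sq
  unfold logLikelihoodRatio
  rw [integral_finsetSum _ fun k _ => integrable_obsLogRatio hM (x k), ← Finset.sum_neg_distrib]
  refine Finset.sum_congr rfl fun k _ => ?_
  have h_bias : ∫ θ, ((x k).2 - M θ (x k).1.1 (x k).1.2) ^ 2 ∂ρ
      = Var[fun θ => M θ (x k).1.1 (x k).1.2; ρ]
        + (M₀ (x k).1.1 (x k).1.2 - (x k).2) ^ 2 := by
    simp_rw [sub_sq_comm (x k).2]
    rw [integral_sub_sq_eq_variance_add (hM _ _), hmean]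
  simp only [obsLogRatio]
  rw [integral_div, integral_sub (integrable_const _) (h_sq k), h_bias, integral_const,
    probReal_univ, integral_sub_sq_eq_variance_add (hM _ _), hmean]
  simp only [smul_eq_mul]
  ring

theorem neg_integral_logLikelihoodRatio_le (hM : ∀ i j, MemLp (fun θ => M θ i j) 2 ρ)
    (hmean : ∀ i j, ∫ θ, M θ i j ∂ρ = M₀ i j) {E : ℝ}
    (hE : ∀ i j, ∫ θ, (M θ i j - M₀ i j) ^ 2 ∂ρ ≤ E) (x : Fin n → Obs m p) :
    -∫ θ, logLikelihoodRatio σ (M θ) M₀ x ∂ρ ≤ n * (E / (2 * σ ^ 2)) := by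
  rw [neg_integral_logLikelihoodRatio hM hmean]
  refine (Finset.sum_le_card_nsmul _ _ (E / (2 * σ ^ 2)) fun k _ => ?_).trans_eq (by simp)
  gcongr
  exact hE _ _

end Unbiased

end Likelihood

section Sampling

variable {m p n : ℕ} {σ : ℝ}

theorem measurable_noisyEntry (M : Matrix (Fin m) (Fin p) ℝ) :
    Measurable fun z : (Fin m × Fin p) × ℝ => (z.1, M z.1.1 z.1.2 + z.2) :=
  measurable_from_prod_countable_right fun z =>
    measurable_const.prodMk (measurable_const_add (M z.1 z.2))

theorem isProbabilityMeasure_obsLaw (hm : 1 ≤ m) (hp : 1 ≤ p) (σ : ℝ)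
    (M : Matrix (Fin m) (Fin p) ℝ) : IsProbabilityMeasure (obsLaw σ M) := by
  have : NeZero m := ⟨by omega⟩
  have : NeZero p := ⟨by omega⟩
  have := isProbabilityMeasure_uniformOn (Set.finite_univ (α := Fin m × Fin p)) Set.univ_nonempty
  exact Measure.isProbabilityMeasure_map (measurable_noisyEntry M).aemeasurable

theorem lintegral_uniformOn_univ {ι : Type*} [Fintype ι] [MeasurableSpace ι]
    [MeasurableSingletonClass ι] (f : ι → ℝ≥0∞) :
    ∫⁻ i, f i ∂(uniformOn Set.univ) = (Fintype.card ι : ℝ≥0∞)⁻¹ * ∑ i, f i := by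
  rw [uniformOn, ProbabilityTheory.cond, Measure.restrict_univ, Measure.count_univ,
    lintegral_smul_measure, lintegral_count, tsum_fintype, smul_eq_mul,
    ENat.card_eq_coe_fintype_card]
  simp

theorem lintegral_obsLaw (σ : ℝ) (M : Matrix (Fin m) (Fin p) ℝ) {f : Obs m p → ℝ≥0∞}
    (hf : Measurable f) :
    ∫⁻ o, f o ∂(obsLaw σ M) = ((m * p : ℕ) : ℝ≥0∞)⁻¹ *
      ∑ z : Fin m × Fin p, ∫⁻ y, f (z, y) ∂(gaussianReal (M z.1 z.2) (σ ^ 2).toNNReal) := by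
  have h_shift (z : Fin m × Fin p) :
      ∫⁻ y, f (z, M z.1 z.2 + y) ∂(gaussianReal 0 (σ ^ 2).toNNReal)
        = ∫⁻ y, f (z, y) ∂(gaussianReal (M z.1 z.2) (σ ^ 2).toNNReal) := by
    rw [← lintegral_map (f := fun y => f (z, y)) (hf.comp measurable_prodMk_left)
      (measurable_const_add (M z.1 z.2)), gaussianReal_map_const_add, zero_add]
  have h_comp : Measurable fun z : (Fin m × Fin p) × ℝ => f (z.1, M z.1.1 z.1.2 + z.2) :=
    hf.comp (measurable_noisyEntry M)
  rw [obsLaw, lintegral_map hf (measurable_noisyEntry M),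
    lintegral_prod _ h_comp.aemeasurable, lintegral_uniformOn_univ,
    Fintype.card_prod, Fintype.card_fin, Fintype.card_fin]
  simp only [h_shift]

theorem lintegral_exp_sq_sub_sq_gaussianReal (hσ : σ ≠ 0) (α c c₀ : ℝ) :
    ∫⁻ y, ENNReal.ofReal (Real.exp (α * (((y - c₀) ^ 2 - (y - c) ^ 2) / (2 * σ ^ 2))))
        ∂(gaussianReal c₀ (σ ^ 2).toNNReal)
      = ENNReal.ofReal (Real.exp (-(α * (1 - α) / (2 * σ ^ 2) * (c - c₀) ^ 2))) := by
  have h_linear (y : ℝ) : Real.exp (α * (((y - c₀) ^ 2 - (y - c) ^ 2) / (2 * σ ^ 2)))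
      = Real.exp (α * (c₀ ^ 2 - c ^ 2) / (2 * σ ^ 2)) * Real.exp (α * (c - c₀) / σ ^ 2 * y) := by
    rw [← Real.exp_add]
    congr 1
    field_simp
    ring
  have h_mgf := congrFun (mgf_fun_id_gaussianReal (μ := c₀) (v := (σ ^ 2).toNNReal))
    (α * (c - c₀) / σ ^ 2)
  rw [mgf, Real.coe_toNNReal _ (sq_nonneg σ)] at h_mgf
  simp_rw [h_linear]
  rw [← ofReal_integral_eq_lintegral_ofReal ((integrable_exp_mul_gaussianReal _).const_mul _)
    (.of_forall fun y => by positivity), integral_const_mul, h_mgf, ← Real.exp_add]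
  congr 2
  field_simp
  ring

theorem lintegral_exp_obsLogRatio (hσ : σ ≠ 0) (α : ℝ) (M M₀ : Matrix (Fin m) (Fin p) ℝ) :
    ∫⁻ o, ENNReal.ofReal (Real.exp (α * obsLogRatio σ M M₀ o)) ∂(obsLaw σ M₀)
      = ((m * p : ℕ) : ℝ≥0∞)⁻¹ * ENNReal.ofReal (∑ z : Fin m × Fin p,
        Real.exp (-(α * (1 - α) / (2 * σ ^ 2) * (M z.1 z.2 - M₀ z.1 z.2) ^ 2))) := by
  have h_meas : Measurable (obsLogRatio σ M M₀) :=
    measurable_obsLogRatio (M := fun _ => M) measurable_id (fun _ _ => measurable_const) M₀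
  rw [lintegral_obsLaw σ M₀ (h_meas.const_mul α).exp.ennreal_ofReal,
    ENNReal.ofReal_sum_of_nonneg fun _ _ => (Real.exp_pos _).le]
  exact congrArg _ (Finset.sum_congr rfl fun z _ =>
    lintegral_exp_sq_sub_sq_gaussianReal hσ α (M z.1 z.2) (M₀ z.1 z.2))

theorem lintegral_pi_prod {ι : Type*} [Fintype ι] {Ω : ι → Type*} [∀ i, MeasurableSpace (Ω i)]
    (μ : ∀ i, Measure (Ω i)) [∀ i, IsProbabilityMeasure (μ i)] {f : ∀ i, Ω i → ℝ≥0∞}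
    (hf : ∀ i, Measurable (f i)) :
    ∫⁻ x, ∏ i, f i (x i) ∂(Measure.pi μ) = ∏ i, ∫⁻ ω, f i ω ∂(μ i) := by
  rw [lintegral_prod_eq_prod_lintegral_of_indepFun Finset.univ
    (fun i (x : ∀ i, Ω i) => f i (x i))
    (iIndepFun_pi fun i => (hf i).aemeasurable) fun i => (hf i).comp (measurable_pi_apply i)]
  exact Finset.prod_congr rfl fun i _ => (measurePreserving_eval μ i).lintegral_comp (hf i)

theorem lintegral_exp_logLikelihoodRatio (hm : 1 ≤ m) (hp : 1 ≤ p) (α : ℝ)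
    (M M₀ : Matrix (Fin m) (Fin p) ℝ) :
    ∫⁻ x, ENNReal.ofReal (Real.exp (α * logLikelihoodRatio σ M M₀ x)) ∂(sampleLaw n σ M₀)
      = (∫⁻ o, ENNReal.ofReal (Real.exp (α * obsLogRatio σ M M₀ o)) ∂(obsLaw σ M₀)) ^ n := by
  have := isProbabilityMeasure_obsLaw hm hp σ M₀
  have h_meas : Measurable (obsLogRatio σ M M₀) :=
    measurable_obsLogRatio (M := fun _ => M) measurable_id (fun _ _ => measurable_const) M₀
  simp only [logLikelihoodRatio, Finset.mul_sum, Real.exp_sum,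
    ENNReal.ofReal_prod_of_nonneg fun _ _ => (Real.exp_pos _).le]
  rw [sampleLaw, lintegral_pi_prod _ fun _ => (h_meas.const_mul α).exp.ennreal_ofReal]
  simp

end Sampling

section ClippedLoss

/-- The slope of the chord of `t ↦ 1 - exp (-c t)` over `[0, T]`. With `T = 4 C ^ 2` it compares
the squared distance between numbers in `[-C, C]` with a Rényi divergence. -/
noncomputable def chordSlope (c T : ℝ) : ℝ := (1 - Real.exp (-(c * T))) / T

theorem chordSlope_pos {c T : ℝ} (hc : 0 < c) (hT : 0 < T) : 0 < chordSlope c T :=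
  div_pos (sub_pos.2 (Real.exp_lt_one_iff.2 (neg_neg_of_pos (mul_pos hc hT)))) hT

theorem chordSlope_mul_le (c : ℝ) {t T : ℝ} (hT : 0 < T) (ht : 0 ≤ t) (htT : t ≤ T) :
    chordSlope c T * t ≤ 1 - Real.exp (-(c * t)) := by
  have h_convex := convexOn_exp.2 (Set.mem_univ (0 : ℝ)) (Set.mem_univ (-(c * T)))
    (sub_nonneg.2 ((div_le_one hT).2 htT)) (div_nonneg ht hT.le) (by ring)
  have h_point : (1 - t / T) • (0 : ℝ) + (t / T) • -(c * T) = -(c * t) := by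
    simp only [smul_eq_mul]
    field_simp
    ring
  rw [h_point, Real.exp_zero, smul_eq_mul, smul_eq_mul] at h_convex
  calc chordSlope c T * t = t / T * (1 - Real.exp (-(c * T))) := by unfold chordSlope; ring
    _ ≤ 1 - Real.exp (-(c * t)) := by linarith

theorem abs_clamp_sub_le {C y : ℝ} (x : ℝ) (hy : |y| ≤ C) :
    |min (max x (-C)) C - y| ≤ |x - y| := by
  obtain ⟨hCy, hyC⟩ := abs_le.1 hy
  calc |min (max x (-C)) C - y|
      = |min (max x (-C)) C - min (max y (-C)) C| := by rw [max_eq_left hCy, min_eq_left hyC]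
    _ ≤ |max x (-C) - max y (-C)| := abs_inf_sub_inf_le_abs _ _ _
    _ ≤ |x - y| := abs_sup_sub_sup_le_abs _ _ _

theorem sq_clamp_sub_le {C y : ℝ} (x : ℝ) (hy : |y| ≤ C) :
    (min (max x (-C)) C - y) ^ 2 ≤ 4 * C ^ 2 := by
  obtain ⟨hCy, hyC⟩ := abs_le.1 hy
  have h_le : min (max x (-C)) C ≤ C := min_le_right _ _
  have h_ge : -C ≤ min (max x (-C)) C := le_min (le_max_right _ _) (by linarith)
  calc (min (max x (-C)) C - y) ^ 2 ≤ (2 * C) ^ 2 := sq_le_sq' (by linarith) (by linarith)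
    _ = 4 * C ^ 2 := by ring

theorem chordSlope_mul_sq_clamp_sub_le {C c y : ℝ} (x : ℝ) (hC : 0 < C) (hc : 0 ≤ c)
    (hy : |y| ≤ C) :
    chordSlope c (4 * C ^ 2) * (min (max x (-C)) C - y) ^ 2
      ≤ 1 - Real.exp (-(c * (x - y) ^ 2)) := by
  refine (chordSlope_mul_le c (by positivity) (sq_nonneg _) (sq_clamp_sub_le x hy)).trans ?_
  have h_sq : (min (max x (-C)) C - y) ^ 2 ≤ (x - y) ^ 2 := sq_le_sq.2 (abs_clamp_sub_le x hy)
  gcongr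

variable {m p : ℕ}

/-- The loss of the theorem: the mean over the entries of the squared error of `clip C M`. -/
noncomputable def clippedLoss (C : ℝ) (M₀ M : Matrix (Fin m) (Fin p) ℝ) : ℝ :=
  frobeniusSq (clip C M - M₀) / ((m : ℝ) * p)

theorem clippedLoss_eq_sum (C : ℝ) (M₀ M : Matrix (Fin m) (Fin p) ℝ) :
    clippedLoss C M₀ M = (∑ z : Fin m × Fin p,
      (min (max (M z.1 z.2) (-C)) C - M₀ z.1 z.2) ^ 2) / ((m : ℝ) * p) := by
  rw [clippedLoss, frobeniusSq, ← Fintype.sum_prod_type']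
  rfl

theorem clippedLoss_nonneg (C : ℝ) (M₀ M : Matrix (Fin m) (Fin p) ℝ) :
    0 ≤ clippedLoss C M₀ M := by
  rw [clippedLoss_eq_sum]
  positivity

theorem clippedLoss_le {C : ℝ} {M₀ : Matrix (Fin m) (Fin p) ℝ} (hM₀ : ∀ i j, |M₀ i j| ≤ C)
    (M : Matrix (Fin m) (Fin p) ℝ) : clippedLoss C M₀ M ≤ 4 * C ^ 2 := by
  rw [clippedLoss_eq_sum]
  refine div_le_of_le_mul₀ (by positivity) (by positivity) ?_
  refine (Finset.sum_le_card_nsmul _ _ (4 * C ^ 2) fun z _ =>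
    sq_clamp_sub_le _ (hM₀ z.1 z.2)).trans_eq ?_
  simp [mul_comm]

theorem measurable_clippedLoss {Ω : Type*} [MeasurableSpace Ω] {M : Ω → Matrix (Fin m) (Fin p) ℝ}
    (hM : ∀ i j, Measurable fun ω => M ω i j) (C : ℝ) (M₀ : Matrix (Fin m) (Fin p) ℝ) :
    Measurable fun ω => clippedLoss C M₀ (M ω) := by
  simp only [clippedLoss_eq_sum]
  exact (Finset.measurable_sum _ fun z _ => ((((hM z.1 z.2).max measurable_const).min
    measurable_const).sub_const _).pow_const 2).div_const _

theorem integrable_clippedLoss {Ω : Type*} [MeasurableSpace Ω] {μ : Measure Ω}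
    [IsFiniteMeasure μ] {M : Ω → Matrix (Fin m) (Fin p) ℝ}
    (hM : ∀ i j, Measurable fun ω => M ω i j) {C : ℝ} {M₀ : Matrix (Fin m) (Fin p) ℝ}
    (hM₀ : ∀ i j, |M₀ i j| ≤ C) : Integrable (fun ω => clippedLoss C M₀ (M ω)) μ := by
  refine .of_bound (measurable_clippedLoss hM C M₀).aestronglyMeasurable (4 * C ^ 2)
    (.of_forall fun ω => ?_)
  rw [Real.norm_of_nonneg (clippedLoss_nonneg C M₀ _)]
  exact clippedLoss_le hM₀ _

theorem sum_exp_neg_sq_sub_le (hm : 1 ≤ m) (hp : 1 ≤ p) {C c : ℝ} (hC : 0 < C) (hc : 0 ≤ c)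
    {M₀ : Matrix (Fin m) (Fin p) ℝ} (hM₀ : ∀ i j, |M₀ i j| ≤ C)
    (M : Matrix (Fin m) (Fin p) ℝ) :
    ∑ z : Fin m × Fin p, Real.exp (-(c * (M z.1 z.2 - M₀ z.1 z.2) ^ 2))
      ≤ m * p * Real.exp (-(chordSlope c (4 * C ^ 2) * clippedLoss C M₀ M)) := by
  have : (m : ℝ) * p ≠ 0 := by positivity
  calc ∑ z : Fin m × Fin p, Real.exp (-(c * (M z.1 z.2 - M₀ z.1 z.2) ^ 2))
      ≤ ∑ z : Fin m × Fin p, (1 - chordSlope c (4 * C ^ 2) *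
          (min (max (M z.1 z.2) (-C)) C - M₀ z.1 z.2) ^ 2) := by
        refine Finset.sum_le_sum fun z _ => ?_
        have := chordSlope_mul_sq_clamp_sub_le (M z.1 z.2) hC hc (hM₀ z.1 z.2)
        linarith
    _ = m * p * (-(chordSlope c (4 * C ^ 2) * clippedLoss C M₀ M) + 1) := by
        rw [clippedLoss_eq_sum, Finset.sum_sub_distrib, ← Finset.mul_sum]
        simp only [Finset.sum_const, Finset.card_univ, Fintype.card_prod, Fintype.card_fin,
          nsmul_eq_mul, mul_one, Nat.cast_mul]
        field_simp
        ring
    _ ≤ m * p * Real.exp (-(chordSlope c (4 * C ^ 2) * clippedLoss C M₀ M)) := by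
        gcongr
        exact Real.add_one_le_exp _

end ClippedLoss

section RiskBound

variable {m p n K : ℕ} {σ α C : ℝ} {M₀ : Matrix (Fin m) (Fin p) ℝ}

theorem lintegral_exp_obsLogRatio_le (hm : 1 ≤ m) (hp : 1 ≤ p) (hσ : σ ≠ 0) (hα : 0 ≤ α)
    (hα1 : α ≤ 1) (hC : 0 < C) (hM₀ : ∀ i j, |M₀ i j| ≤ C) (M : Matrix (Fin m) (Fin p) ℝ) :
    ∫⁻ o, ENNReal.ofReal (Real.exp (α * obsLogRatio σ M M₀ o)) ∂(obsLaw σ M₀)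
      ≤ ENNReal.ofReal (Real.exp
        (-(chordSlope (α * (1 - α) / (2 * σ ^ 2)) (4 * C ^ 2) * clippedLoss C M₀ M))) := by
  have hc : 0 ≤ α * (1 - α) / (2 * σ ^ 2) :=
    div_nonneg (mul_nonneg hα (sub_nonneg.2 hα1)) (by positivity)
  have hmp : ((m * p : ℕ) : ℝ≥0∞) ≠ 0 := Nat.cast_ne_zero.2 (by positivity)
  rw [lintegral_exp_obsLogRatio hσ, ENNReal.inv_mul_le_iff hmp (ENNReal.natCast_ne_top _),
    ← ENNReal.ofReal_natCast, ← ENNReal.ofReal_mul (by positivity), Nat.cast_mul]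
  exact ENNReal.ofReal_le_ofReal (sum_exp_neg_sq_sub_le hm hp hC hc hM₀ M)

theorem lintegral_exp_logLikelihoodRatio_add_clippedLoss_le (hm : 1 ≤ m) (hp : 1 ≤ p)
    (hσ : σ ≠ 0) (hα : 0 ≤ α) (hα1 : α ≤ 1) (hC : 0 < C) (hM₀ : ∀ i j, |M₀ i j| ≤ C)
    (M : Matrix (Fin m) (Fin p) ℝ) :
    ∫⁻ x, ENNReal.ofReal (Real.exp (α * logLikelihoodRatio σ M M₀ x
        + n * chordSlope (α * (1 - α) / (2 * σ ^ 2)) (4 * C ^ 2) * clippedLoss C M₀ M))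
      ∂(sampleLaw n σ M₀) ≤ 1 := by
  set s := chordSlope (α * (1 - α) / (2 * σ ^ 2)) (4 * C ^ 2)
  simp_rw [Real.exp_add, ENNReal.ofReal_mul (Real.exp_pos _).le]
  rw [lintegral_mul_const' _ _ ENNReal.ofReal_ne_top, lintegral_exp_logLikelihoodRatio hm hp]
  calc _ ≤ ENNReal.ofReal (Real.exp (-(s * clippedLoss C M₀ M))) ^ n
        * ENNReal.ofReal (Real.exp (n * s * clippedLoss C M₀ M)) := by
        gcongr
        exact lintegral_exp_obsLogRatio_le hm hp hσ hα hα1 hC hM₀ M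
    _ = ENNReal.ofReal (Real.exp (n * -(s * clippedLoss C M₀ M) + n * s * clippedLoss C M₀ M)) := by
        rw [← ENNReal.ofReal_pow (Real.exp_pos _).le, ← Real.exp_nat_mul,
          ← ENNReal.ofReal_mul (Real.exp_pos _).le, ← Real.exp_add]
    _ = 1 := by simp [mul_assoc]

theorem isProbabilityMeasure_of_mem_meanField {ρ : Measure (Param m p K)}
    (hρ : ρ ∈ meanField m p K) : IsProbabilityMeasure ρ := by
  obtain ⟨ρU, ρV, ργ, hU, hV, hγ, rfl⟩ := hρ
  infer_instance

theorem lintegral_clippedLoss_le {a b : ℝ} (hm : 1 ≤ m) (hp : 1 ≤ p) (hn : 1 ≤ n) (ha : 0 < a)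
    (hb : 0 < b) (hσ : σ ≠ 0) (hα : 0 < α) (hα1 : α < 1) (hC : 0 < C)
    (hM₀ : ∀ i j, |M₀ i j| ≤ C) {ρ : Measure (Param m p K)} (hρ : ρ ∈ meanField m p K)
    (hρ_memLp : ∀ i j, MemLp (fun θ : Param m p K => θ.toMatrix i j) 2 ρ)
    (hρ_mean : ∀ i j, ∫ θ, θ.toMatrix i j ∂ρ = M₀ i j) {E : ℝ}
    (hE : ∀ i j, ∫ θ, (θ.toMatrix i j - M₀ i j) ^ 2 ∂ρ ≤ E)
    {vb : (Fin n → Obs m p) → Measure (Param m p K)}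
    (hvb : ∀ x, IsVBApprox a b σ α x (vb x)) :
    ∫⁻ x, ∫⁻ θ, ENNReal.ofReal (clippedLoss C M₀ θ.toMatrix) ∂(vb x) ∂(sampleLaw n σ M₀)
      ≤ (klDiv ρ (prior m p K a b) + ENNReal.ofReal (α * (n * (E / (2 * σ ^ 2)))))
        / ENNReal.ofReal (n * chordSlope (α * (1 - α) / (2 * σ ^ 2)) (4 * C ^ 2)) := by
  have := isProbabilityMeasure_of_mem_meanField hρ
  have := isProbabilityMeasure_prior (m := m) (p := p) (K := K) ha hb
  have (x : Fin n → Obs m p) := isProbabilityMeasure_of_mem_meanField (hvb x).2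
  have := isProbabilityMeasure_obsLaw hm hp σ M₀
  have : IsProbabilityMeasure (sampleLaw n σ M₀) := by unfold sampleLaw; infer_instance
  have hslope := chordSlope_pos (c := α * (1 - α) / (2 * σ ^ 2)) (T := 4 * C ^ 2)
    (div_pos (mul_pos hα (sub_pos.2 hα1)) (by positivity)) (by positivity)
  set s := chordSlope (α * (1 - α) / (2 * σ ^ 2)) (4 * C ^ 2)
  have hns : 0 < n * s := by positivity
  have h_ratio : Measurable fun w : (Fin n → Obs m p) × Param m p K =>
      α * logLikelihoodRatio σ w.2.toMatrix M₀ w.1 :=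
    (measurable_logLikelihoodRatio measurable_fst
      (fun i j => (measurable_toMatrix_apply i j).comp measurable_snd) M₀).const_mul α
  have h_min (x : Fin n → Obs m p) :
      klDiv (vb x) ((prior m p K a b).tilted fun θ => α * logLikelihoodRatio σ θ.toMatrix M₀ x)
        ≤ klDiv ρ
          ((prior m p K a b).tilted fun θ => α * logLikelihoodRatio σ θ.toMatrix M₀ x) := by
    rw [← fracPosterior_eq_tilted hσ]
    exact (hvb x).1 hρ
  have h_fit (x : Fin n → Obs m p) :
      -∫ θ, α * logLikelihoodRatio σ θ.toMatrix M₀ x ∂ρ ≤ α * (n * (E / (2 * σ ^ 2))) := by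
    rw [integral_const_mul, ← mul_neg]
    exact mul_le_mul_of_nonneg_left
      (neg_integral_logLikelihoodRatio_le hρ_memLp hρ_mean hE x) hα.le
  have h_oracle := lintegral_lintegral_le_klDiv_add h_ratio
    ((measurable_clippedLoss measurable_toMatrix_apply C M₀).const_mul (n * s))
    (fun θ => mul_nonneg hns.le (clippedLoss_nonneg C M₀ _))
    (integrable_exp_logLikelihoodRatio _ hα.le measurable_toMatrix_apply M₀)
    (fun x => (integrable_logLikelihoodRatio hρ_memLp x).const_mul α)
    (fun x => (integrable_clippedLoss measurable_toMatrix_apply hM₀).const_mul (n * s))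
    (fun θ => lintegral_exp_logLikelihoodRatio_add_clippedLoss_le hm hp hσ hα.le hα1.le hC hM₀ _)
    h_min h_fit
  rw [ENNReal.le_div_iff_mul_le (.inl (ENNReal.ofReal_pos.2 hns).ne')
    (.inl ENNReal.ofReal_ne_top), mul_comm]
  simpa only [ENNReal.ofReal_mul hns.le, lintegral_const_mul' _ _ ENNReal.ofReal_ne_top]
    using h_oracle

end RiskBound

section Constants

variable {a : ℝ}

theorem log_Gamma_add_le_constC (ha : 0 < a) :
    Real.log (Real.Gamma a) + (10 * a + 4) * Real.log 2 + 3 ≤ constC a := by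
  have hΓ := Real.Gamma_pos_of_pos ha
  have hπ : 0 ≤ Real.log √Real.pi :=
    Real.log_nonneg (Real.one_le_sqrt.2 (by linarith [Real.pi_gt_three]))
  have h8 : Real.log 8 = 3 * Real.log 2 := by
    rw [show (8 : ℝ) = 2 ^ 3 by norm_num, Real.log_pow, Nat.cast_ofNat]
  rw [constC, Real.log_mul (by positivity) (by positivity),
    Real.log_mul (by positivity) hΓ.ne', Real.log_mul (by norm_num) (by positivity),
    Real.log_rpow (by norm_num), h8]
  linarith

theorem constC_nonneg (ha : 0 < a) : 0 ≤ constC a := by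
  have hlog : 0 ≤ Real.log 2 := Real.log_nonneg one_le_two
  have hΓ := neg_two_add_log_two_le_log_Gamma ha
  linarith [log_Gamma_add_le_constC ha, mul_nonneg ha.le hlog]

variable {n m p K : ℕ} {B : ℝ}

theorem one_le_cast_mul_mul (hn : 1 ≤ n) (hm : 1 ≤ m) (hp : 1 ≤ p) : (1 : ℝ) ≤ n * m * p :=
  mod_cast Nat.mul_pos (Nat.mul_pos hn hm) hp

theorem cast_add_le_two_mul (hn : 1 ≤ n) (hm : 1 ≤ m) (hp : 1 ≤ p) :
    (m : ℝ) + p ≤ 2 * (n * m * p) := by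
  have hmul : m * p ≤ n * m * p := by
    rw [mul_assoc]; exact Nat.le_mul_of_pos_left _ hn
  have hadd : m + p ≤ 2 * (n * m * p) := by
    linarith [Nat.le_mul_of_pos_right m hp, Nat.le_mul_of_pos_left p hm]
  exact_mod_cast hadd

theorem one_le_cast_max_mul (hm : 1 ≤ m) (hK : 1 ≤ K) : (1 : ℝ) ≤ (max m p : ℕ) * K :=
  mod_cast Nat.mul_pos (lt_max_of_lt_left hm) hK

theorem cast_max_mul_le (hn : 1 ≤ n) (hK : K ≤ min m p) :
    ((max m p : ℕ) : ℝ) * K ≤ n * m * p := by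
  have hmp : max m p * K ≤ n * m * p :=
    calc max m p * K ≤ max m p * min m p := Nat.mul_le_mul_left _ hK
      _ = m * p := max_mul_min m p
      _ ≤ n * m * p := by rw [mul_assoc]; exact Nat.le_mul_of_pos_left _ hn
  exact_mod_cast hmp

theorem bChoice_pos (hn : 1 ≤ n) (hm : 1 ≤ m) (hp : 1 ≤ p) (hK : 1 ≤ K) (hB : 0 < B) :
    0 < bChoice n m p K B := by
  have := one_le_cast_mul_mul hn hm hp
  have := one_le_cast_max_mul (p := p) hm hK
  unfold bChoice
  positivity

theorem bChoice_le (hn : 1 ≤ n) (hm : 1 ≤ m) (hp : 1 ≤ p) (hK : 1 ≤ K) :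
    bChoice n m p K B ≤ (B / (n * m * p)) ^ 2 := by
  have hN := one_le_cast_mul_mul hn hm hp
  have hX := one_le_cast_max_mul (p := p) hm hK
  rw [bChoice, div_pow]
  gcongr
  calc ((n : ℝ) * m * p) ^ 2 ≤ (n * m * p) ^ 4 := pow_le_pow_right₀ hN (by norm_num)
    _ ≤ 512 * (n * m * p) ^ 4 := le_mul_of_one_le_left (by positivity) (by norm_num)
    _ ≤ _ := le_mul_of_one_le_right (by positivity) (one_le_pow₀ hX)

theorem log_two_mul_sq_div_bChoice_le (hn : 1 ≤ n) (hm : 1 ≤ m) (hp : 1 ≤ p) (hK : 1 ≤ K)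
    (hK_le : K ≤ min m p) (hB : 0 < B) :
    Real.log (2 * B ^ 2 / bChoice n m p K B)
      ≤ 10 * Real.log 2 + 6 * Real.log ((n : ℝ) * m * p) := by
  have hN := one_le_cast_mul_mul hn hm hp
  have hX := one_le_cast_max_mul (p := p) hm hK
  have hXN := cast_max_mul_le hn hK_le
  set N := (n : ℝ) * m * p
  set X := ((max m p : ℕ) : ℝ) * K
  have : 0 < N := one_pos.trans_le hN
  have : 0 < X := one_pos.trans_le hX
  calc Real.log (2 * B ^ 2 / bChoice n m p K B) = Real.log (2 ^ 10 * (N ^ 4 * X ^ 2)) := by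
        congr 1
        change 2 * B ^ 2 / (B ^ 2 / (512 * N ^ 4 * X ^ 2)) = _
        field_simp
        norm_num
    _ ≤ Real.log (2 ^ 10 * (N ^ 4 * N ^ 2)) := by gcongr
    _ = 10 * Real.log 2 + 6 * Real.log N := by
        rw [← pow_add, Real.log_mul (by positivity) (by positivity), Real.log_pow, Real.log_pow]
        norm_num

end Constants

section ColumnCosts

variable {a b B N S : ℝ}

theorem neg_log_invGammaMeasure_real_Icc_two_mul_le (ha : 0 < a) (hB : 0 < B) (hb : 0 < b)
    (hbB : b ≤ B) :
    -Real.log ((invGammaMeasure a b).real (Set.Icc B (2 * B)))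
      ≤ Real.log 2 + a * Real.log (2 * B / b) + 1 + Real.log (Real.Gamma a) := by
  have hlog := neg_log_invGammaMeasure_real_Icc_le ha hb hB (by linarith : B < 2 * B)
  have hratio : 2 * B / (2 * B - B) = 2 := by field_simp; ring
  rw [hratio] at hlog
  linarith [(div_le_one hB).2 hbB]

theorem neg_log_invGammaMeasure_real_Icc_div_le (ha : 0 < a) (hb : 0 < b) (hS : 2 ≤ S) :
    -Real.log ((invGammaMeasure a b).real (Set.Icc (b / (1 + 1 / S)) b))
      ≤ Real.log S + 2 + Real.log (Real.Gamma a) := by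
  have hS0 : 0 < S := by linarith
  have hinv : 0 < 1 / S := by positivity
  have hinv_le : 1 / S ≤ 1 / 2 := one_div_le_one_div_of_le (by norm_num) hS
  have hlt : b / (1 + 1 / S) < b := div_lt_self hb (by linarith)
  have hwidth : b / (b - b / (1 + 1 / S)) = S * (1 + 1 / S) := by
    rw [div_eq_iff (sub_pos.2 hlt).ne']
    field_simp
    ring
  have hlog := neg_log_invGammaMeasure_real_Icc_le ha hb (by positivity) hlt
  rw [hwidth, div_div_cancel₀ hb.ne', div_self hb.ne', Real.log_one,
    Real.log_mul hS0.ne' (by positivity)] at hlog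
  linarith [Real.log_le_sub_one_of_pos (by positivity : 0 < 1 + 1 / S)]

theorem entryCost_sq_le (hB : 0 < B) (hN : 0 < N) (hS : 0 < S) (hSN : S ≤ 2 * N ^ 4) :
    entryCost (B ^ 2) (2 * B ^ 2) (S / (2 * N ^ 4) * B ^ 2) B
      ≤ 2 * Real.log N + Real.log 2 - Real.log S / 2 + 1 / 2 := by
  have hratio : 2 * B ^ 2 / (S / (2 * N ^ 4) * B ^ 2) = 2 ^ 2 * N ^ 4 / S := by field_simp
  have hquot : (S / (2 * N ^ 4) * B ^ 2 + B ^ 2) / B ^ 2 = S / (2 * N ^ 4) + 1 := by field_simp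
  have hSN' : S / (2 * N ^ 4) ≤ 1 := (div_le_one (by positivity)).2 hSN
  rw [entryCost, hratio, hquot, Real.log_div (by positivity) hS.ne',
    Real.log_mul (by positivity) (by positivity), Real.log_pow, Real.log_pow]
  push_cast
  linarith

theorem entryCost_div_self_zero (hb : 0 < b) (hS : 0 < S) :
    entryCost (b / (1 + 1 / S)) b b 0 = 1 / (2 * S) := by
  rw [entryCost, div_self hb.ne', Real.log_one]
  field_simp
  ring

/-- The two bracketed terms are the costs of a signal column and of a null column. The `K - r`
null columns cost about `log S` each, which `K - r ≤ r * S / 2` absorbs into the term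
`-log S / 2` of the `S` entries of a signal column. -/
theorem column_costs_le {r K S a L G l s : ℝ} (hr : 1 ≤ r) (hrK : r ≤ K) (hKS : 2 * K ≤ S)
    (ha : 0 ≤ a) (hL : 0 ≤ L) (hl : 0 ≤ l) (hG : -(2 + l) ≤ G) (hs : 0 ≤ s) :
    r * (l + a * (10 * l + 6 * L) + 1 + G + S * (2 * L + l - s / 2 + 1 / 2))
        + (K - r) * (s + 2 + G + S * (1 / (2 * S)))
      ≤ r * (S * (2 * (1 + 2 * a) * (L + (G + (10 * a + 4) * l + 3)))) := by
  obtain ⟨G', rfl⟩ : ∃ G', G = G' - (2 + l) := ⟨G + (2 + l), by ring⟩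
  have hG' : 0 ≤ G' := by linarith
  have hS : 2 ≤ S := by linarith
  have hKrS : K - r ≤ r * (S / 2) := by nlinarith
  have hhalf : S * (1 / (2 * S)) = 1 / 2 := by field_simp
  have hnull : (K - r) * (s + 2 + (G' - (2 + l)) + 1 / 2) ≤ r * (S / 2) * (s + 1 / 2 + G') :=
    calc _ ≤ (K - r) * (s + 1 / 2 + G') :=
          mul_le_mul_of_nonneg_left (by linarith) (sub_nonneg.2 hrK)
      _ ≤ _ := by gcongr
  have hsignal : l + a * (10 * l + 6 * L) + 1 + (G' - (2 + l))
      ≤ S / 2 * (a * (10 * l + 6 * L) + G') :=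
    calc _ ≤ a * (10 * l + 6 * L) + G' := by linarith
      _ ≤ _ := le_mul_of_one_le_left (by positivity) (by linarith)
  have hslack : 0 ≤ G' + 5 * l + 5 / 4 + a * (27 * l + L + 4 * G' + 40 * a * l + 4) := by
    positivity
  rw [hhalf]
  calc _ ≤ r * (S / 2 * (a * (10 * l + 6 * L) + G') + S * (2 * L + l - s / 2 + 1 / 2))
        + r * (S / 2) * (s + 1 / 2 + G') := by gcongr
    _ = r * (S * (2 * L + 3 * (a * L) + 5 * (a * l) + l + G' + 3 / 4)) := by ring
    _ ≤ _ := by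
        gcongr
        linarith

end ColumnCosts

section LowRankReference

variable {m p K r : ℕ} {a b B N : ℝ}

/-- The function of the column index equal to `x` on the first `r` columns and to `y` on the
others. -/
def columnSplit {β : Type*} (r : ℕ) (x y : β) (k : Fin K) : β :=
  if (k : ℕ) < r then x else y

theorem columnSplit_of_lt {β : Type*} {x y : β} {k : Fin K} (hk : (k : ℕ) < r) :
    columnSplit r x y k = x :=
  if_pos hk

theorem columnSplit_of_le {β : Type*} {x y : β} {k : Fin K} (hk : r ≤ (k : ℕ)) :
    columnSplit r x y k = y :=
  if_neg hk.not_gt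

theorem sum_le_of_columnSplit (hrK : r ≤ K) {f : Fin K → ℝ} {x y : ℝ}
    (hx : ∀ k : Fin K, (k : ℕ) < r → f k ≤ x) (hy : ∀ k : Fin K, r ≤ (k : ℕ) → f k ≤ y) :
    ∑ k, f k ≤ r * x + (K - r) * y := by
  obtain ⟨d, rfl⟩ := Nat.exists_eq_add_of_le hrK
  have hfirst := Finset.sum_le_card_nsmul Finset.univ (fun i : Fin r => f (Fin.castAdd d i)) x
    fun i _ => hx _ i.2
  have hlast := Finset.sum_le_card_nsmul Finset.univ (fun i : Fin d => f (Fin.natAdd r i)) y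
    fun i _ => hy _ (Nat.le_add_right r i)
  simp only [Finset.card_univ, Fintype.card_fin, nsmul_eq_mul] at hfirst hlast
  rw [Fin.sum_univ_add]
  push_cast
  linarith

theorem abs_le_columnSplit_of_mem_factorClass
    {W : Matrix (Fin m) (Fin K) ℝ × Matrix (Fin p) (Fin K) ℝ} (hW : W ∈ factorClass m p K r B) :
    (∀ i k, |W.1 i k| ≤ columnSplit r B 0 k) ∧ ∀ j k, |W.2 j k| ≤ columnSplit r B 0 k := by
  obtain ⟨hU0, hUB, hV0, hVB⟩ := hW
  constructor <;> intro i k <;> rcases lt_or_ge (k : ℕ) r with hk | hk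
  · exact (hUB i k).trans_eq (columnSplit_of_lt hk).symm
  · rw [hU0 i k hk, columnSplit_of_le hk, abs_zero]
  · exact (hVB i k).trans_eq (columnSplit_of_lt hk).symm
  · rw [hV0 i k hk, columnSplit_of_le hk, abs_zero]

/-- The lower end of the range to which the variance of the `k`-th column is restricted. -/
noncomputable def varLower (r : ℕ) (B b S : ℝ) : Fin K → ℝ :=
  columnSplit r (B ^ 2) (b / (1 + 1 / S))

/-- The upper end of the range to which the variance of the `k`-th column is restricted. -/
noncomputable def varUpper (r : ℕ) (B b : ℝ) : Fin K → ℝ :=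
  columnSplit r (2 * B ^ 2) b

/-- The variance given to the entries of the `k`-th column. -/
noncomputable def varEntry (r : ℕ) (B b S N : ℝ) : Fin K → ℝ≥0 :=
  columnSplit r (S / (2 * N ^ 4) * B ^ 2).toNNReal b.toNNReal

/-- The comparison law for factors whose columns vanish after the first `r`: the signal columns
are known up to a small variance, while the variances of the null columns are concentrated near
`b`, where the prior puts enough mass. -/
noncomputable def lowRankLaw (a b B N : ℝ) (r : ℕ) (U : Fin m → Fin K → ℝ)
    (V : Fin p → Fin K → ℝ) : Measure (Param m p K) :=
  refLaw (fun k => (invGammaMeasure a b)[|Set.Icc (varLower r B b (m + p) k) (varUpper r B b k)])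
    U V (varEntry r B b (m + p) N)

theorem varLower_pos {S : ℝ} (hB : 0 < B) (hb : 0 < b) (hS : 0 < S) (k : Fin K) :
    0 < varLower r B b S k := by
  unfold varLower columnSplit
  split_ifs <;> positivity

theorem varLower_lt_varUpper {S : ℝ} (hB : 0 < B) (hb : 0 < b) (hS : 0 < S) (k : Fin K) :
    varLower r B b S k < varUpper r B b k := by
  unfold varLower varUpper columnSplit
  split_ifs
  · linarith [pow_pos hB 2]
  · exact div_lt_self hb (lt_add_of_pos_right 1 (one_div_pos.2 hS))

theorem varEntry_ne_zero {S : ℝ} (hB : 0 < B) (hb : 0 < b) (hN : 0 < N) (hS : 0 < S)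
    (k : Fin K) : varEntry r B b S N k ≠ 0 := by
  unfold varEntry columnSplit
  split_ifs
  · exact (Real.toNNReal_pos.2 (by positivity)).ne'
  · exact (Real.toNNReal_pos.2 hb).ne'

theorem klDiv_lowRankLaw_le (ha : 0 < a) (hb : 0 < b) (hB : 0 < B) (hN : 1 ≤ N) (hr : 1 ≤ r)
    (hrK : r ≤ K) (hK : K ≤ min m p) (hSN : (m : ℝ) + p ≤ 2 * N ^ 4) (hbB : b ≤ B ^ 2)
    (hlog : Real.log (2 * B ^ 2 / b) ≤ 10 * Real.log 2 + 6 * Real.log N)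
    {U : Fin m → Fin K → ℝ} {V : Fin p → Fin K → ℝ}
    (hU : ∀ i k, |U i k| ≤ columnSplit r B 0 k) (hV : ∀ j k, |V j k| ≤ columnSplit r B 0 k) :
    klDiv (lowRankLaw a b B N r U V) (prior m p K a b)
      ≤ ENNReal.ofReal (r * ((m + p) * (2 * (1 + 2 * a) * (Real.log N + constC a)))) := by
  have hN0 : 0 < N := one_pos.trans_le hN
  have hr' : (1 : ℝ) ≤ r := mod_cast hr
  have hrK' : (r : ℝ) ≤ K := mod_cast hrK
  have hKS : 2 * (K : ℝ) ≤ m + p := mod_cast (by omega : 2 * K ≤ m + p)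
  have hS : (2 : ℝ) ≤ m + p := by linarith
  have hS0 : (0 : ℝ) < m + p := by linarith
  refine (klDiv_refLaw_cond_le ha hb (varLower_pos hB hb hS0) (varLower_lt_varUpper hB hb hS0)
    (varEntry_ne_zero hB hb hN0 hS0) hU hV).trans (ENNReal.ofReal_le_ofReal ?_)
  refine (sum_le_of_columnSplit hrK
    (x := Real.log 2 + a * (10 * Real.log 2 + 6 * Real.log N) + 1 + Real.log (Real.Gamma a)
      + (m + p) * (2 * Real.log N + Real.log 2 - Real.log (m + p) / 2 + 1 / 2))
    (y := Real.log (m + p) + 2 + Real.log (Real.Gamma a) + (m + p) * (1 / (2 * (m + p))))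
    (fun k hk => ?signal) fun k hk => ?null).trans ?total
  case signal =>
    simp only [varLower, varUpper, varEntry, columnSplit_of_lt hk]
    rw [Real.coe_toNNReal _ (by positivity)]
    gcongr
    · refine (neg_log_invGammaMeasure_real_Icc_two_mul_le ha (pow_pos hB 2) hb hbB).trans ?_
      gcongr
    · exact entryCost_sq_le hB hN0 hS0 hSN
  case null =>
    simp only [varLower, varUpper, varEntry, columnSplit_of_le hk]
    rw [Real.coe_toNNReal _ hb.le, entryCost_div_self_zero hb hS0]
    gcongr
    exact neg_log_invGammaMeasure_real_Icc_div_le ha hb hS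
  case total =>
    refine (column_costs_le hr' hrK' hKS ha.le (Real.log_nonneg hN)
      (Real.log_nonneg one_le_two) (neg_two_add_log_two_le_log_Gamma ha)
      (Real.log_nonneg (by linarith))).trans ?_
    gcongr
    exact log_Gamma_add_le_constC ha

theorem varEntry_error_le {S : ℝ} {k : Fin K} {x y : ℝ} (hb : 0 < b) (hN : 1 ≤ N) (hS : 0 ≤ S)
    (hSN : S ≤ 2 * N ^ 4) (hbN : b ≤ (B / N) ^ 2) (hx : |x| ≤ columnSplit r B 0 k)
    (hy : |y| ≤ columnSplit r B 0 k) :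
    (varEntry r B b S N k : ℝ) ^ 2 + varEntry r B b S N k * (x ^ 2 + y ^ 2)
      ≤ columnSplit r (3 / 2 * S) 1 k * (B / N) ^ 4 := by
  have hN0 : 0 < N := one_pos.trans_le hN
  rcases lt_or_ge (k : ℕ) r with hk | hk
  · rw [columnSplit_of_lt hk] at hx hy ⊢
    have hxB : x ^ 2 ≤ B ^ 2 := sq_le_sq.2 (hx.trans (le_abs_self B))
    have hyB : y ^ 2 ≤ B ^ 2 := sq_le_sq.2 (hy.trans (le_abs_self B))
    have hv : S / (2 * N ^ 4) * B ^ 2 ≤ B ^ 2 :=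
      mul_le_of_le_one_left (sq_nonneg B) ((div_le_one (by positivity)).2 hSN)
    rw [varEntry, columnSplit_of_lt hk, Real.coe_toNNReal _ (by positivity), sq, ← mul_add]
    calc _ ≤ S / (2 * N ^ 4) * B ^ 2 * (B ^ 2 + (B ^ 2 + B ^ 2)) := by gcongr
      _ = 3 / 2 * S * (B / N) ^ 4 := by field_simp; ring
  · rw [columnSplit_of_le hk] at hx hy ⊢
    rw [varEntry, columnSplit_of_le hk, Real.coe_toNNReal _ hb.le, abs_nonpos_iff.1 hx,
      abs_nonpos_iff.1 hy]
    calc b ^ 2 + b * (0 ^ 2 + 0 ^ 2) = b ^ 2 := by ring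
      _ ≤ ((B / N) ^ 2) ^ 2 := by gcongr
      _ = 1 * (B / N) ^ 4 := by ring

theorem sum_varEntry_error_le (hb : 0 < b) (hN : 1 ≤ N) (hr : 1 ≤ r) (hrK : r ≤ K)
    (hK : K ≤ min m p) (hSN : (m : ℝ) + p ≤ 2 * N ^ 4) (hbN : b ≤ (B / N) ^ 2) {u v : Fin K → ℝ}
    (hu : ∀ k, |u k| ≤ columnSplit r B 0 k) (hv : ∀ k, |v k| ≤ columnSplit r B 0 k) :
    ∑ k, ((varEntry r B b (m + p) N k : ℝ) ^ 2
        + varEntry r B b (m + p) N k * (u k ^ 2 + v k ^ 2))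
      ≤ r * ((m + p) * (2 * (B / N) ^ 4)) := by
  have hr' : (1 : ℝ) ≤ r := mod_cast hr
  have hKS : 2 * (K : ℝ) ≤ m + p := mod_cast (by omega : 2 * K ≤ m + p)
  have herror := fun k => varEntry_error_le hb hN (by positivity) hSN hbN (hu k) (hv k)
  have hnull : (K : ℝ) - r ≤ r * ((m + p) / 2) := by nlinarith
  calc _ ≤ r * (3 / 2 * (m + p) * (B / N) ^ 4) + (K - r) * (1 * (B / N) ^ 4) :=
        sum_le_of_columnSplit hrK
          (fun k hk => (herror k).trans_eq (by rw [columnSplit_of_lt hk]))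
          fun k hk => (herror k).trans_eq (by rw [columnSplit_of_le hk])
    _ ≤ r * (3 / 2 * (m + p) * (B / N) ^ 4) + r * ((m + p) / 2) * (1 * (B / N) ^ 4) := by gcongr
    _ = r * ((m + p) * (2 * (B / N) ^ 4)) := by ring

theorem exists_meanField_of_mem_factorClass {n : ℕ} (hn : 1 ≤ n) (hr : 1 ≤ r) (hrK : r ≤ K)
    (hK : K ≤ min m p) (ha : 0 < a) (hB : 0 < B)
    {W : Matrix (Fin m) (Fin K) ℝ × Matrix (Fin p) (Fin K) ℝ} (hW : W ∈ factorClass m p K r B) :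
    ∃ ρ ∈ meanField m p K, (∀ i j, MemLp (fun θ => θ.toMatrix i j) 2 ρ) ∧
      (∀ i j, ∫ θ, θ.toMatrix i j ∂ρ = (W.1 * W.2ᵀ) i j) ∧
      (∀ i j, ∫ θ, (θ.toMatrix i j - (W.1 * W.2ᵀ) i j) ^ 2 ∂ρ
        ≤ r * ((m + p) * (2 * (B / (n * m * p)) ^ 4))) ∧
      klDiv ρ (prior m p K a (bChoice n m p K B))
        ≤ ENNReal.ofReal
          (r * ((m + p) * (2 * (1 + 2 * a) * (Real.log (n * m * p) + constC a)))) := by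
  obtain ⟨U, V⟩ := W
  obtain ⟨hU, hV⟩ := abs_le_columnSplit_of_mem_factorClass hW
  have hK1 : 1 ≤ K := hr.trans hrK
  have hm : 1 ≤ m := hK1.trans (hK.trans (min_le_left _ _))
  have hp : 1 ≤ p := hK1.trans (hK.trans (min_le_right _ _))
  have hN := one_le_cast_mul_mul hn hm hp
  have hb := bChoice_pos hn hm hp hK1 hB
  have hbN := bChoice_le (B := B) hn hm hp hK1
  have hbB : bChoice n m p K B ≤ B ^ 2 :=
    hbN.trans (pow_le_pow_left₀ (by positivity) (div_le_self hB.le hN) 2)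
  have hSN : (m : ℝ) + p ≤ 2 * (n * m * p) ^ 4 := (cast_add_le_two_mul hn hm hp).trans
    (mul_le_mul_of_nonneg_left (le_self_pow₀ hN (by norm_num)) zero_le_two)
  have hS : (0 : ℝ) < m + p := by positivity
  set b := bChoice n m p K B
  have := isProbabilityMeasure_invGammaMeasure ha hb
  have hprob : ∀ k : Fin K, IsProbabilityMeasure
      ((invGammaMeasure a b)[|Set.Icc (varLower r B b (m + p) k) (varUpper r B b k)]) := fun k =>
    cond_isProbabilityMeasure (invGammaMeasure_Icc_ne_zero ha hb (varLower_pos hB hb hS k)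
      (varLower_lt_varUpper hB hb hS k))
  have hUV : ∀ i j, (U * Vᵀ) i j = ∑ k, U i k * V j k := fun i j => rfl
  refine ⟨lowRankLaw a b B (n * m * p) r (fun i k => U i k) fun j k => V j k,
    refLaw_mem_meanField .., memLp_toMatrix_apply _ _ _ _, integral_toMatrix_apply _ _ _ _,
    fun i j => ?_,
    klDiv_lowRankLaw_le ha hb hB hN hr hrK hK hSN hbB
      (log_two_mul_sq_div_bChoice_le hn hm hp hK1 hK hB) hU hV⟩
  simp only [hUV]
  exact (integral_toMatrix_apply_sub_sq _ _ _ _ i j).trans_le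
    (sum_varEntry_error_le hb hN hr hrK hK hSN hbN (hU i) (hV j))

end LowRankReference

section FinalBound

theorem chordSlope_clip (C α σ : ℝ) :
    chordSlope (α * (1 - α) / (2 * σ ^ 2)) (4 * C ^ 2)
      = (1 - Real.exp (2 * C ^ 2 * α * (α - 1) / σ ^ 2)) / (4 * C ^ 2) := by
  rw [chordSlope]
  congr 3
  ring

theorem add_error_le {n m p r a α σ B Q : ℝ} (hn : 0 < n) (hm : 0 < m) (hp : 0 < p) (hr : 0 ≤ r)
    (ha : 0 ≤ a) (hα : 0 ≤ α) (hB : 0 ≤ B) (hQ : 0 ≤ Q) :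
    r * ((m + p) * (2 * (1 + 2 * a) * Q))
        + α * (n * (r * ((m + p) * (2 * (B / (n * m * p)) ^ 4)) / (2 * σ ^ 2)))
      ≤ 2 * (1 + α) * (1 + 2 * a) * r * (m + p)
        * (Q + α * B / (2 * σ ^ 2 * m * p) * max 1 ((B / (n * m * p)) ^ 3)) := by
  set T := α * B / (2 * σ ^ 2 * m * p) * max 1 ((B / (n * m * p)) ^ 3) with hT
  have : 0 ≤ T := by positivity
  have herror : α * (n * (r * ((m + p) * (2 * (B / (n * m * p)) ^ 4)) / (2 * σ ^ 2)))
      ≤ r * (m + p) * (2 * T) :=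
    calc _ = r * (m + p) * (2 * (α * B / (2 * σ ^ 2 * m * p) * (B / (n * m * p)) ^ 3)) := by
          field_simp
      _ ≤ _ := by rw [hT]; gcongr; exact le_max_right _ _
  calc _ ≤ r * ((m + p) * (2 * (1 + 2 * a) * Q)) + r * (m + p) * (2 * T) := by gcongr
    _ ≤ r * ((m + p) * (2 * (1 + 2 * a) * Q)) + r * (m + p) * (2 * T)
        + r * (m + p) * (2 * (2 * a * T + α * ((1 + 2 * a) * (Q + T)))) :=
      le_add_of_nonneg_right (by positivity)
    _ = _ := by ring

theorem divergence_add_error_div_le {n m p r a α σ B C Q : ℝ} (hn : 0 < n) (hm : 0 < m)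
    (hp : 0 < p) (hr : 0 ≤ r) (ha : 0 ≤ a) (hα : 0 < α) (hα1 : α < 1) (hσ : σ ≠ 0) (hB : 0 ≤ B)
    (hC : 0 < C) (hQ : 0 ≤ Q) :
    (ENNReal.ofReal (r * ((m + p) * (2 * (1 + 2 * a) * Q)))
        + ENNReal.ofReal
          (α * (n * (r * ((m + p) * (2 * (B / (n * m * p)) ^ 4)) / (2 * σ ^ 2)))))
        / ENNReal.ofReal (n * chordSlope (α * (1 - α) / (2 * σ ^ 2)) (4 * C ^ 2))
      ≤ ENNReal.ofReal (8 * C ^ 2 * (1 + α) * (1 + 2 * a) * r * (m + p)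
        * (Q + α * B / (2 * σ ^ 2 * m * p) * max 1 ((B / (n * m * p)) ^ 3))
        / (n * (1 - Real.exp (2 * C ^ 2 * α * (α - 1) / σ ^ 2)))) := by
  have : 0 < 1 - α := sub_pos.2 hα1
  have hslope : 0 < chordSlope (α * (1 - α) / (2 * σ ^ 2)) (4 * C ^ 2) :=
    chordSlope_pos (by positivity) (by positivity)
  rw [← ENNReal.ofReal_add (by positivity) (by positivity),
    ← ENNReal.ofReal_div_of_pos (by positivity)]
  refine ENNReal.ofReal_le_ofReal ((div_le_div_of_nonneg_right
    (add_error_le hn hm hp hr ha hα.le hB hQ) (by positivity)).trans_eq ?_)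
  rw [chordSlope_clip, mul_div_assoc', div_div_eq_mul_div]
  ring

end FinalBound

end MatrixCompletionVB

theorem mainTheorem11
    (n m p K r : ℕ) (hn : 1 ≤ n) (hr : 1 ≤ r) (hrK : r ≤ K) (hK : K ≤ min m p)
    (a B C σ α : ℝ) (ha : 0 < a) (hB : 0 < B) (hC : 0 < C) (hσ : 0 < σ)
    (hα : 0 < α) (hα1 : α < 1)
    (M₀ : Matrix (Fin m) (Fin p) ℝ)
    (Ubar : Matrix (Fin m) (Fin K) ℝ) (Vbar : Matrix (Fin p) (Fin K) ℝ)
    (hUV : (Ubar, Vbar) ∈ MatrixCompletionVB.factorClass m p K r B)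
    (hM₀ : M₀ = Ubar * Vbarᵀ)
    (hM₀C : ∀ i j, |M₀ i j| ≤ C)
    (vb : (Fin n → MatrixCompletionVB.Obs m p) → Measure (MatrixCompletionVB.Param m p K))
    (hvb : ∀ x, MatrixCompletionVB.IsVBApprox a (MatrixCompletionVB.bChoice n m p K B) σ α x
      (vb x)) :
    ∫⁻ x, ∫⁻ θ, ENNReal.ofReal
        (MatrixCompletionVB.frobeniusSq (MatrixCompletionVB.clip C θ.toMatrix - M₀)
          / ((m : ℝ) * p)) ∂(vb x)
      ∂(MatrixCompletionVB.sampleLaw n σ M₀)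
    ≤ ENNReal.ofReal
        (8 * C ^ 2 * (1 + α) * (1 + 2 * a) * r * ((m : ℝ) + p) *
            (Real.log ((n : ℝ) * m * p) + MatrixCompletionVB.constC a
              + α * B / (2 * σ ^ 2 * m * p) * max 1 ((B / ((n : ℝ) * m * p)) ^ 3))
          / (n * (1 - Real.exp (2 * C ^ 2 * α * (α - 1) / σ ^ 2)))) := by
  have hK_pos : 0 < K := hr.trans hrK
  have hm : 1 ≤ m := hK_pos.trans_le (hK.trans (min_le_left _ _))
  have hp : 1 ≤ p := hK_pos.trans_le (hK.trans (min_le_right _ _))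
  have hb := MatrixCompletionVB.bChoice_pos hn hm hp hK_pos hB
  have hbracket : 0 ≤ Real.log ((n : ℝ) * m * p) + MatrixCompletionVB.constC a :=
    add_nonneg (Real.log_nonneg (MatrixCompletionVB.one_le_cast_mul_mul hn hm hp))
      (MatrixCompletionVB.constC_nonneg ha)
  subst hM₀
  obtain ⟨ρ, hρ, hρ_memLp, hρ_mean, hρ_error, hρ_klDiv⟩ :=
    MatrixCompletionVB.exists_meanField_of_mem_factorClass hn hr hrK hK ha hB hUV
  calc _ ≤ (InformationTheory.klDiv ρ (MatrixCompletionVB.prior m p K a _)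
          + ENNReal.ofReal (α * (n * (_ / (2 * σ ^ 2)))))
        / ENNReal.ofReal (n * MatrixCompletionVB.chordSlope (α * (1 - α) / (2 * σ ^ 2))
          (4 * C ^ 2)) :=
        MatrixCompletionVB.lintegral_clippedLoss_le hm hp hn ha hb hσ.ne' hα hα1 hC hM₀C
          hρ hρ_memLp hρ_mean hρ_error hvb
    _ ≤ _ := by gcongr
    _ ≤ _ := MatrixCompletionVB.divergence_add_error_div_le (by positivity) (by positivity)
        (by positivity) (by positivity) ha.le hα hα1 hσ.ne' hB.le hC hbracket
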